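/- **Conventions.** Let $Q$ be a finite quiver with vertex set $I$, arrows also denoted $Q$, and head and tail maps $h,t:Q\to I$. Its double $\overline Q$ has in addition, for each $a\in Q$, a dual arrow $a^*$ with the same end points and the opposite direction. Let $\mathbb{C}\overline Q$ be its path algebra (paths are written from right to left), with idempotents $e_i$, $i\in I$, graded by the number of dual arrows: $\mathbb{C}\overline Q=\bigoplus_r\mathbb{C}\overline Q^r$. Let $\mathcal{V}Q$ be the graded vector space obtained from $\mathbb{C}\overline Q$ by dividing out the linear span of all $PR-(-1)^{pr}RP$ with $P\in\mathbb{C}\overline Q^p$, $R\in\mathbb{C}\overline Q^r$; paths that are not closed are zero in $\mathcal{V}Q$. For an arrow $w$ of $\overline Q$, the superderivative $D_w:\mathcal{V}Q\to\mathbb{C}\overline Q$ is given on closed paths by $$D_w(x_1\cdots x_n)=\sum_{x_i=w}(-1)^{\lambda_i\mu_i}x_{i+1}\cdots x_nx_1\cdots x_{i-1},$$ where $\lambda_i$ (resp. $\mu_i$) is the number of dual arrows among $x_{i+1},\dots,x_n$ (resp. $x_1,\dots,x_i$), and an empty product is the trivial path at $t(w)$. For $\gamma\in\mathcal{V}^rQ$,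 $\delta\in\mathcal{V}^sQ$ the Schouten bracket is the class in $\mathcal{V}Q$ of $$[\gamma,\delta]=\sum_{a\in Q}\bigl(D_{a^*}(\gamma)D_a(\delta)-(-1)^{(r-1)(s-1)}D_{a^*}(\delta)D_a(\gamma)\bigr).$$ A *Poisson structure on $\mathbb{C}Q$* is an element $\Pi\in\mathcal{V}^2Q$ with $[\Pi,\Pi]=0$. **Contraction.** Let $j\in I$ and let $a_1,\dots,a_s\in Q$ be arrows with $h(a_m)=j$ and $t(a_m)=v_m$, where $v_m\neq j$ for all $m$ and the $v_m$ are pairwise distinct. The quiver $Q'$ has vertices $I\setminus\{j\}$ and the following arrows: * (i) each $b\in Q$ with $h(b)\ne j$ and $t(b)\neq j$ is kept; * (ii) the arrows $a_1,\dots,a_s$ are removed; * (iii) each $b$ with $t(b)=j$, $h(b)\ne j$ is replaced by $s$ arrows, from $v_m$ to $h(b)$, $m=1,\dots,s$; * (iv) each $b\notin\{a_1,\dots,a_s\}$ with $h(b)=j$, $t(b)\neq j$ is replaced by $s$ arrows, from $t(b)$ to $v_m$, $m=1,\dots,s$; * (v) each $b$ with $h(b)=t(b)=j$ is replaced by $s^2$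 arrows, one from $v_n$ to $v_m$ for each pair $(m,n)$. For $b\in Q\setminus\{a_1,\dots,a_s\}$ write $c_{b,i}$ for the arrows of $Q'$ that replace $b$ (just $b$ itself in case (i)). **Substitution.** For $\Pi\in\mathcal{V}Q$ let $\Pi'\in\mathcal{V}Q'$ be obtained by writing $\Pi$ as a linear combination of closed paths of $\overline Q$ and substituting in them: $\sum_ic_{b,i}$ for $b$ and $\sum_ic_{b,i}^*$ for $b^*$, if $b\in Q\setminus\{a_1,\dots,a_s\}$; $e_{v_m}$ for $a_m$; and for $a_m^*$ $$e_{v_m}\sum_{t(b)=j}\ \sum_{i,l}c_{b,i}^*c_{b,l}\;-\;e_{v_m}\sum_{\substack{h(b)=j\\ b\notin\{a_1,\dots,a_s\}}}\ \sum_{i,l}c_{b,i}c_{b,l}^*.$$ (A trivial path $e_i$ with $i\ne j$ is kept and $e_j$ becomes $\sum_me_{v_m}$. The result does not depend on the choice of the closed paths.) **Proposition.** If $\Pi$ is a Poisson structure on $\mathbb{C}Q$, then $\Pi'$ is a Poisson structure on $\mathbb{C}Q'$. -/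

import Mathlib

/-- A quiver with vertex type `V` and set of arrows `E`, given by its head and tail maps. -/
structure ArrowQuiver (V E : Type*) where
  head : E → V
  tail : E → V

namespace ArrowQuiver

variable {V E : Type*}

/-- The double quiver: `Sum.inl a` is the arrow `a`, and `Sum.inr a` is the dual arrow `a*`,
which runs in the opposite direction. -/
def double (Q : ArrowQuiver V E) : ArrowQuiver V (E ⊕ E) where
  head := Sum.elim Q.head Q.tail
  tail := Sum.elim Q.tail Q.head

/-- `Q.IsWalk t w s`: the word `w = x₁ ⋯ xₙ` is a path from `s` to `t`. Paths are written from
right to left, so the tail of `xᵢ` is the head of `xᵢ₊₁`. The empty word is a walk from each vertex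
to itself. -/
def IsWalk (Q : ArrowQuiver V E) : V → List E → V → Prop
  | t, [], s => t = s
  | t, x :: w, s => Q.head x = t ∧ Q.IsWalk (Q.tail x) w s

theorem IsWalk.append {Q : ArrowQuiver V E} {t m s : V} {u w : List E}
    (hu : Q.IsWalk t u m) (hw : Q.IsWalk m w s) : Q.IsWalk t (u ++ w) s := by
  induction u generalizing t with
  | nil => cases hu; exact hw
  | cons x u ih => exact ⟨hu.1, ih hu.2⟩

/-- A path of the quiver, with its end point `tgt` and its starting point `src`. The trivial paths
are those with the empty word. -/
@[ext]
structure Path (Q : ArrowQuiver V E) where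
  tgt : V
  word : List E
  src : V
  isWalk : Q.IsWalk tgt word src

/-- The trivial path at a vertex. -/
def Path.trivial (Q : ArrowQuiver V E) (i : V) : Q.Path := ⟨i, [], i, rfl⟩

/-- An arrow as a path of length one. -/
def Path.ofArrow (Q : ArrowQuiver V E) (x : E) : Q.Path := ⟨Q.head x, [x], Q.tail x, rfl, rfl⟩

/-- Concatenation `p q` of composable paths (first `q`, then `p`). -/
def Path.comp {Q : ArrowQuiver V E} (p q : Q.Path) (h : p.src = q.tgt) : Q.Path :=
  ⟨p.tgt, p.word ++ q.word, q.src, p.isWalk.append (h ▸ q.isWalk)⟩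

/-- The path algebra over the complex numbers: the vector space with basis the paths. -/
def PathAlgebra (Q : ArrowQuiver V E) : Type _ := Q.Path →₀ ℂ

namespace PathAlgebra

variable (Q : ArrowQuiver V E)

noncomputable instance : AddCommGroup Q.PathAlgebra := inferInstanceAs (AddCommGroup (Q.Path →₀ ℂ))

noncomputable instance : Module ℂ Q.PathAlgebra := inferInstanceAs (Module ℂ (Q.Path →₀ ℂ))

variable {Q}

/-- The basis element of the path algebra given by a path. -/
noncomputable def ofPath (p : Q.Path) : Q.PathAlgebra := Finsupp.single p 1

/-- The idempotent at a vertex. -/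
noncomputable def idem (Q : ArrowQuiver V E) (i : V) : Q.PathAlgebra := ofPath (Path.trivial Q i)

/-- An arrow as an element of the path algebra. -/
noncomputable def arrow (Q : ArrowQuiver V E) (x : E) : Q.PathAlgebra := ofPath (Path.ofArrow Q x)

/-- The linear map out of the path algebra with prescribed values on paths. -/
noncomputable def lift {M : Type*} [AddCommGroup M] [Module ℂ M] (f : Q.Path → M) :
    Q.PathAlgebra →ₗ[ℂ] M :=
  Finsupp.linearCombination ℂ f

@[simp]
theorem lift_ofPath {M : Type*} [AddCommGroup M] [Module ℂ M] (f : Q.Path → M) (p : Q.Path) :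
    lift f (ofPath p) = f p :=
  (Finsupp.linearCombination_single ℂ 1 p).trans (one_smul ℂ _)

theorem hom_ext {M : Type*} [AddCommGroup M] [Module ℂ M] {f g : Q.PathAlgebra →ₗ[ℂ] M}
    (h : ∀ p, f (ofPath p) = g (ofPath p)) : f = g := by
  refine Finsupp.lhom_ext' fun p => LinearMap.ext_ring ?_
  exact h p

theorem induction_on {P : Q.PathAlgebra → Prop} (x : Q.PathAlgebra) (h0 : P 0)
    (hadd : ∀ x y, P x → P y → P (x + y)) (hsmul : ∀ (c : ℂ) (p : Q.Path), P (c • ofPath p)) :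
    P x := by
  refine Finsupp.induction_linear x h0 hadd fun p c => ?_
  have h := hsmul c p
  have e : c • ofPath p = (Finsupp.single p c : Q.Path →₀ ℂ) := by
    change c • (Finsupp.single p 1 : Q.Path →₀ ℂ) = _
    simp
  rwa [e] at h

variable [DecidableEq V]

/-- Multiplication of the path algebra: concatenation of paths, and `0` if the paths cannot be
concatenated. -/
noncomputable def mulHom : Q.PathAlgebra →ₗ[ℂ] Q.PathAlgebra →ₗ[ℂ] Q.PathAlgebra :=
  lift fun p => lift fun q => if h : p.src = q.tgt then ofPath (p.comp q h) else 0

noncomputable instance : Mul Q.PathAlgebra := ⟨fun x y => mulHom x y⟩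

theorem mul_def (x y : Q.PathAlgebra) : x * y = mulHom x y := rfl

theorem ofPath_mul_ofPath (p q : Q.Path) :
    ofPath p * ofPath q = if h : p.src = q.tgt then ofPath (p.comp q h) else 0 := by
  simp [mul_def, mulHom]

theorem trivial_mul (i : V) (p : Q.Path) :
    ofPath (Path.trivial Q i) * ofPath p = if i = p.tgt then ofPath p else 0 := by
  rw [ofPath_mul_ofPath]
  by_cases h : i = p.tgt
  · subst h
    simp [Path.trivial, Path.comp]
  · simp [Path.trivial, h]

theorem mul_trivial (i : V) (p : Q.Path) :
    ofPath p * ofPath (Path.trivial Q i) = if i = p.src then ofPath p else 0 := by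
  rw [ofPath_mul_ofPath]
  by_cases h : i = p.src
  · subst h
    simp [Path.trivial, Path.comp]
  · simp [Path.trivial, h, Ne.symm h]

variable [Fintype V]

noncomputable instance : One Q.PathAlgebra := ⟨∑ i : V, ofPath (Path.trivial Q i)⟩

protected theorem one_mul (x : Q.PathAlgebra) : 1 * x = x := by
  suffices h : mulHom (1 : Q.PathAlgebra) = LinearMap.id from congrArg (fun f => f x) h
  refine hom_ext fun p => ?_
  rw [show (1 : Q.PathAlgebra) = ∑ i : V, ofPath (Path.trivial Q i) from rfl, map_sum,
    LinearMap.sum_apply]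
  simp only [← mul_def, trivial_mul]
  simp

protected theorem mul_one (x : Q.PathAlgebra) : x * 1 = x := by
  suffices h : mulHom.flip (1 : Q.PathAlgebra) = LinearMap.id from congrArg (fun f => f x) h
  refine hom_ext fun p => ?_
  rw [LinearMap.flip_apply,
    show (1 : Q.PathAlgebra) = ∑ i : V, ofPath (Path.trivial Q i) from rfl, map_sum]
  simp only [← mul_def, mul_trivial]
  simp

protected theorem mul_assoc (x y z : Q.PathAlgebra) : x * y * z = x * (y * z) := by
  simp only [mul_def]
  induction x using induction_on with
  | h0 => simp
  | hadd x x' hx hx' => simp only [map_add, LinearMap.add_apply, hx, hx']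
  | hsmul a p =>
  induction y using induction_on with
  | h0 => simp
  | hadd y y' hy hy' => simp only [map_add, LinearMap.add_apply, hy, hy']
  | hsmul b q =>
  induction z using induction_on with
  | h0 => simp
  | hadd z z' hz hz' => simp only [map_add, hz, hz']
  | hsmul c r =>
  simp only [map_smul, LinearMap.smul_apply]
  congr 3
  rw [← mul_def, ← mul_def, ← mul_def, ← mul_def, ofPath_mul_ofPath p q, ofPath_mul_ofPath q r]
  have mz (x : Q.PathAlgebra) : x * 0 = 0 := by simp [mul_def]
  have zm (x : Q.PathAlgebra) : 0 * x = 0 := by simp [mul_def]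
  by_cases h1 : p.src = q.tgt <;> by_cases h2 : q.src = r.tgt <;>
    simp [h1, h2, ofPath_mul_ofPath, Path.comp, mz, zm]

noncomputable instance : Ring Q.PathAlgebra :=
  { (inferInstance : AddCommGroup Q.PathAlgebra) with
    mul := (· * ·)
    one := 1
    mul_assoc := PathAlgebra.mul_assoc
    one_mul := PathAlgebra.one_mul
    mul_one := PathAlgebra.mul_one
    left_distrib := fun x y z => by simp [mul_def]
    right_distrib := fun x y z => by simp [mul_def]
    zero_mul := fun x => by simp [mul_def]
    mul_zero := fun x => by simp [mul_def] }

theorem smul_mul_eq (c : ℂ) (x y : Q.PathAlgebra) : (c • x) * y = c • (x * y) := by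
  simp [mul_def]

theorem mul_smul_eq (c : ℂ) (x y : Q.PathAlgebra) : x * (c • y) = c • (x * y) := by
  simp [mul_def]

end PathAlgebra

open PathAlgebra

/-! ### Noncommutative polyvector fields and the Schouten bracket -/

/-- The number of dual arrows in a word in the arrows of the double quiver. -/
def dualCount (w : List (E ⊕ E)) : ℕ := w.countP Sum.isRight

theorem dualCount_append (u w : List (E ⊕ E)) :
    dualCount (u ++ w) = dualCount u + dualCount w := List.countP_append

/-- The homogeneous part of degree `r` of the path algebra of the double quiver, spanned by the
paths with exactly `r` dual arrows. -/
noncomputable def homogeneous (Q : ArrowQuiver V E) (r : ℕ) : Submodule ℂ Q.double.PathAlgebra :=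
  Submodule.span ℂ {x | ∃ p : Q.double.Path, dualCount p.word = r ∧ x = ofPath p}

section Schouten

variable [DecidableEq V] [Fintype V]

/-- The linear span of all `P R - (-1)^(p r) R P`, with `P` homogeneous of degree `p` and `R`
homogeneous of degree `r`. -/
noncomputable def superCommutators (Q : ArrowQuiver V E) : Submodule ℂ Q.double.PathAlgebra :=
  Submodule.span ℂ {x | ∃ (p r : ℕ) (P R : Q.double.PathAlgebra),
    P ∈ Q.homogeneous p ∧ R ∈ Q.homogeneous r ∧ x = P * R - (-1 : ℂ) ^ (p * r) • (R * P)}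

/-- The space of noncommutative polyvector fields of `Q` (graded necklaces): the path algebra of
the double quiver modulo supercommutators. -/
abbrev Polyvector (Q : ArrowQuiver V E) : Type _ := Q.double.PathAlgebra ⧸ Q.superCommutators

/-- The class of an element of the path algebra of the double quiver. -/
noncomputable def toPolyvector (Q : ArrowQuiver V E) : Q.double.PathAlgebra →ₗ[ℂ] Q.Polyvector :=
  Q.superCommutators.mkQ

/-- The polyvector fields of degree `r`. -/
noncomputable def polyvectorDegree (Q : ArrowQuiver V E) (r : ℕ) : Submodule ℂ Q.Polyvector :=
  (Q.homogeneous r).map Q.toPolyvector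

/-- To check that a linear map vanishes on supercommutators it is enough to look at paths. -/
theorem superCommutators_le_ker {Q : ArrowQuiver V E} {M : Type*} [AddCommGroup M] [Module ℂ M]
    (f : Q.double.PathAlgebra →ₗ[ℂ] M)
    (h : ∀ p r : Q.double.Path, f (ofPath p * ofPath r) =
      (-1 : ℂ) ^ (dualCount p.word * dualCount r.word) • f (ofPath r * ofPath p)) :
    Q.superCommutators ≤ LinearMap.ker f := by
  refine Submodule.span_le.2 ?_
  rintro _ ⟨m, n, P, R, hP, hR, rfl⟩
  rw [SetLike.mem_coe, LinearMap.mem_ker, map_sub, map_smul, sub_eq_zero]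
  induction hP using Submodule.span_induction with
  | zero => simp
  | add x y _ _ hx hy => rw [add_mul, mul_add, map_add, map_add, hx, hy, smul_add]
  | smul c x _ hx => rw [smul_mul_eq, mul_smul_eq, map_smul, map_smul, hx, smul_comm]
  | mem x hx =>
    obtain ⟨p, rfl, rfl⟩ := hx
    induction hR using Submodule.span_induction with
    | zero => simp
    | add x y _ _ hx hy => rw [add_mul, mul_add, map_add, map_add, hx, hy, smul_add]
    | smul c x _ hx => rw [smul_mul_eq, mul_smul_eq, map_smul, map_smul, hx, smul_comm]
    | mem y hy =>
      obtain ⟨r, rfl, rfl⟩ := hy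
      exact h p r

section Derivative

open Classical in
/-- The `i`-th term (counting from `0`) of the superderivative of the closed word `x` with respect
to the letter `w`. If the `i`-th letter is `w`, it is the rotated word starting after that letter
and ending before it, with its sign. The idempotent only matters if this word is empty. -/
noncomputable def superDerivTerm (Q : ArrowQuiver V E) (w : E ⊕ E) (x : List (E ⊕ E)) (i : ℕ) :
    Q.double.PathAlgebra :=
  if x[i]? = some w then
    (-1 : ℂ) ^ (dualCount (x.drop (i + 1)) * dualCount (x.take (i + 1))) •
      (idem Q.double (Q.double.tail w) *
        ((x.drop (i + 1) ++ x.take i).map (arrow Q.double)).prod)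
  else 0

/-- The superderivative of a path; it is zero on paths that are not closed, since these vanish as
polyvector fields. -/
noncomputable def superDerivPath (Q : ArrowQuiver V E) (w : E ⊕ E) (p : Q.double.Path) :
    Q.double.PathAlgebra :=
  if p.tgt = p.src then ∑ i ∈ Finset.range p.word.length, Q.superDerivTerm w p.word i else 0

theorem superDerivPath_closed (Q : ArrowQuiver V E) (w : E ⊕ E) {p : Q.double.Path}
    (h : p.tgt = p.src) :
    Q.superDerivPath w p = ∑ i ∈ Finset.range p.word.length, Q.superDerivTerm w p.word i :=
  if_pos h

theorem superDerivPath_of_ne (Q : ArrowQuiver V E) (w : E ⊕ E) {p : Q.double.Path}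
    (h : p.tgt ≠ p.src) : Q.superDerivPath w p = 0 :=
  if_neg h

theorem superDerivTerm_append (Q : ArrowQuiver V E) (w : E ⊕ E) (u v : List (E ⊕ E)) (i : ℕ)
    (hi : i < u.length) :
    Q.superDerivTerm w (u ++ v) i =
      (-1 : ℂ) ^ (dualCount u * dualCount v) • Q.superDerivTerm w (v ++ u) (v.length + i) := by
  have e1 : (u ++ v)[i]? = u[i]? := List.getElem?_append_left hi
  have e2 : (v ++ u)[v.length + i]? = u[i]? := by
    rw [List.getElem?_append_right (by omega)]; congr 1; omega
  have hd : (u ++ v).drop (i + 1) = u.drop (i + 1) ++ v := List.drop_append_of_le_length hi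
  have ht : (u ++ v).take (i + 1) = u.take (i + 1) := List.take_append_of_le_length hi
  have ht' : (u ++ v).take i = u.take i := List.take_append_of_le_length hi.le
  have kd : (v ++ u).drop (v.length + i + 1) = u.drop (i + 1) := by
    rw [add_assoc, List.drop_append]; simp
  have kt : (v ++ u).take (v.length + i + 1) = v ++ u.take (i + 1) := by
    rw [add_assoc, List.take_append]; simp
  have kt' : (v ++ u).take (v.length + i) = v ++ u.take i := by
    rw [List.take_append]; simp
  have hu : dualCount u = dualCount (u.take (i + 1)) + dualCount (u.drop (i + 1)) := by
    rw [← dualCount_append, List.take_append_drop]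
  unfold superDerivTerm
  rw [e1, e2, hd, ht, ht', kd, kt, kt', hu, dualCount_append, dualCount_append]
  split_ifs
  · rw [smul_smul, ← pow_add, List.append_assoc]
    congr 1
    generalize dualCount (u.take (i + 1)) = a
    generalize dualCount (u.drop (i + 1)) = b
    generalize dualCount v = c
    have : (a + b) * c + b * (c + a) = (b + c) * a + 2 * (b * c) := by ring
    rw [this, pow_add, pow_mul]
    simp
  · simp

theorem sum_superDerivTerm_append (Q : ArrowQuiver V E) (w : E ⊕ E) (u v : List (E ⊕ E)) :
    ∑ i ∈ Finset.range (u ++ v).length, Q.superDerivTerm w (u ++ v) i =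
      (-1 : ℂ) ^ (dualCount u * dualCount v) •
        ∑ i ∈ Finset.range (v ++ u).length, Q.superDerivTerm w (v ++ u) i := by
  have sq (n : ℕ) : (-1 : ℂ) ^ n * (-1 : ℂ) ^ n = 1 := by rw [← mul_pow]; simp
  rw [List.length_append, List.length_append, Finset.sum_range_add, Finset.sum_range_add, smul_add,
    add_comm]
  congr 1
  · rw [Finset.smul_sum]
    refine Finset.sum_congr rfl fun i hi => ?_
    rw [Q.superDerivTerm_append w v u i (Finset.mem_range.1 hi), smul_smul,
      Nat.mul_comm (dualCount v), sq, one_smul]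
  · rw [Finset.smul_sum]
    exact Finset.sum_congr rfl fun i hi => Q.superDerivTerm_append w u v i (Finset.mem_range.1 hi)

/-- The directional superderivative `D_w`, for an arrow `w` of the double quiver. -/
noncomputable def superDeriv (Q : ArrowQuiver V E) (w : E ⊕ E) :
    Q.Polyvector →ₗ[ℂ] Q.double.PathAlgebra :=
  Q.superCommutators.liftQ (lift (Q.superDerivPath w)) <| by
    refine superCommutators_le_ker _ fun p r => ?_
    rw [ofPath_mul_ofPath, ofPath_mul_ofPath]
    by_cases h1 : p.src = r.tgt <;> by_cases h2 : r.src = p.tgt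
    · rw [dif_pos h1, dif_pos h2, lift_ofPath, lift_ofPath,
        superDerivPath_closed _ _ (p := p.comp r h1) h2.symm,
        superDerivPath_closed _ _ (p := r.comp p h2) h1.symm]
      exact Q.sum_superDerivTerm_append w p.word r.word
    · rw [dif_pos h1, dif_neg h2, lift_ofPath,
        superDerivPath_of_ne _ _ (p := p.comp r h1) (Ne.symm h2), map_zero, smul_zero]
    · rw [dif_neg h1, dif_pos h2, lift_ofPath,
        superDerivPath_of_ne _ _ (p := r.comp p h2) (Ne.symm h1), map_zero, smul_zero]
    · rw [dif_neg h1, dif_neg h2]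
      simp

end Derivative

/-- The Schouten bracket of polyvector fields `γ` of degree `r` and `δ` of degree `s`. -/
noncomputable def schouten [Fintype E] (Q : ArrowQuiver V E) (r s : ℕ) (γ δ : Q.Polyvector) :
    Q.Polyvector :=
  Q.toPolyvector (∑ a : E,
    (Q.superDeriv (Sum.inr a) γ * Q.superDeriv (Sum.inl a) δ -
      (-1 : ℂ) ^ (((r : ℤ) - 1) * ((s : ℤ) - 1)) •
        (Q.superDeriv (Sum.inr a) δ * Q.superDeriv (Sum.inl a) γ)))

/-- A Poisson structure on the path algebra of `Q`: a polyvector field of degree two whose Schouten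
bracket with itself vanishes. -/
def IsPoisson [Fintype E] (Q : ArrowQuiver V E) (P : Q.Polyvector) : Prop :=
  P ∈ Q.polyvectorDegree 2 ∧ Q.schouten 2 2 P P = 0

end Schouten

/-! ### Contraction along several arrows meeting at a vertex -/

/-- Arrows `a₁, …, a_s` which end at the vertex `j` and start at distinct vertices
`v₁, …, v_s` different from `j`. -/
structure Fan (Q : ArrowQuiver V E) (j : V) (s : ℕ) where
  arr : Fin s → E
  head_arr : ∀ m, Q.head (arr m) = j
  tail_ne : ∀ m, Q.tail (arr m) ≠ j
  tail_injective : Function.Injective fun m => Q.tail (arr m)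

variable {Q : ArrowQuiver V E} {j : V} {s : ℕ}

/-- The starting vertex `v_m` of `a_m`, as a vertex of the contracted quiver. -/
def Fan.vertex (a : Q.Fan j s) (m : Fin s) : {i : V // i ≠ j} := ⟨Q.tail (a.arr m), a.tail_ne m⟩

/-- The arrows of the contracted quiver. The arrows `a_m` are removed; an arrow not meeting `j` is
kept; an arrow `b` starting (only) at `j` is replaced by arrows `c_{b,m}` starting at the `v_m`; an
arrow ending (only) at `j` is replaced by arrows `c_{b,m}` ending at the `v_m`; a loop at `j` is
replaced by arrows from `v_n` to `v_m`, one for each pair `(m, n)`. -/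
inductive Fan.Arrow (a : Q.Fan j s) : Type _
  | keep (b : E) (hh : Q.head b ≠ j) (ht : Q.tail b ≠ j)
  | outgoing (b : E) (hh : Q.head b ≠ j) (ht : Q.tail b = j) (m : Fin s)
  | incoming (b : E) (hh : Q.head b = j) (ht : Q.tail b ≠ j) (hb : b ∉ Set.range a.arr) (m : Fin s)
  | loop (b : E) (hh : Q.head b = j) (ht : Q.tail b = j) (m n : Fin s)

/-- The arrow of the original quiver from which an arrow of the contracted quiver arises. -/
def Fan.Arrow.base {a : Q.Fan j s} : a.Arrow → E
  | keep b _ _ => b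
  | outgoing b _ _ _ => b
  | incoming b _ _ _ _ => b
  | loop b _ _ _ _ => b

/-- The indices by which an arrow of the contracted quiver is labelled (head, tail). -/
def Fan.Arrow.label {a : Q.Fan j s} : a.Arrow → Option (Fin s) × Option (Fin s)
  | keep _ _ _ => (none, none)
  | outgoing _ _ _ m => (none, some m)
  | incoming _ _ _ _ m => (some m, none)
  | loop _ _ _ m n => (some m, some n)

instance (a : Q.Fan j s) [Finite E] : Finite a.Arrow :=
  Finite.of_injective (fun c => (c.base, c.label)) fun c d h => by
    cases c <;> cases d <;> simp_all [Fan.Arrow.base, Fan.Arrow.label]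

noncomputable instance (a : Q.Fan j s) [Fintype E] : Fintype a.Arrow := Fintype.ofFinite _

/-- The contracted quiver, with vertices all vertices other than `j`. -/
def contract (Q : ArrowQuiver V E) (a : Q.Fan j s) : ArrowQuiver {i : V // i ≠ j} a.Arrow where
  head
    | .keep b hh _ => ⟨Q.head b, hh⟩
    | .outgoing b hh _ _ => ⟨Q.head b, hh⟩
    | .incoming _ _ _ _ m => a.vertex m
    | .loop _ _ _ m _ => a.vertex m
  tail
    | .keep b _ ht => ⟨Q.tail b, ht⟩
    | .outgoing _ _ _ m => a.vertex m
    | .incoming b _ ht _ _ => ⟨Q.tail b, ht⟩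
    | .loop _ _ _ _ n => a.vertex n

namespace Fan

variable [DecidableEq V] [Fintype V] [Fintype E]

open Classical in
/-- The sum of all arrows `c_{b,i}` into which `b` is decomposed. -/
noncomputable def split (a : Q.Fan j s) (b : E) : (Q.contract a).double.PathAlgebra :=
  ∑ c : a.Arrow with c.base = b, arrow _ (Sum.inl c)

open Classical in
/-- The sum of all dual arrows `c_{b,i}*` of those into which `b` is decomposed. -/
noncomputable def splitDual (a : Q.Fan j s) (b : E) : (Q.contract a).double.PathAlgebra :=
  ∑ c : a.Arrow with c.base = b, arrow _ (Sum.inr c)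

open Classical in
/-- The element substituted for `a_m*`. -/
noncomputable def dualValue (a : Q.Fan j s) (m : Fin s) : (Q.contract a).double.PathAlgebra :=
  idem _ (a.vertex m) * (∑ b : E with Q.tail b = j, a.splitDual b * a.split b) -
    idem _ (a.vertex m) *
      (∑ b : E with Q.head b = j ∧ b ∉ Set.range a.arr, a.split b * a.splitDual b)

open Classical in
/-- The substitution on arrows of the double quiver: `a_m` is replaced by the idempotent at `v_m`,
`a_m*` by `a.dualValue m`, and every other arrow by the sum of the arrows into which it is
decomposed. -/
noncomputable def substArrow (a : Q.Fan j s) : E ⊕ E → (Q.contract a).double.PathAlgebra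
  | .inl b => if h : ∃ m, a.arr m = b then idem _ (a.vertex h.choose) else a.split b
  | .inr b => if h : ∃ m, a.arr m = b then a.dualValue h.choose else a.splitDual b

/-- The substitution on trivial paths: the one at `j` becomes the sum of those at the `v_m`. -/
noncomputable def substVertex (a : Q.Fan j s) (i : V) : (Q.contract a).double.PathAlgebra :=
  if h : i = j then ∑ m, idem _ (a.vertex m) else idem _ ⟨i, h⟩

/-- The substitution on paths. -/
noncomputable def substPath (a : Q.Fan j s) (p : Q.double.Path) :
    (Q.contract a).double.PathAlgebra :=
  if p.word = [] then a.substVertex p.src else (p.word.map a.substArrow).prod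

/-- The substitution on closed paths, as a polyvector field on the contracted quiver. Paths that are
not closed vanish as polyvector fields and are sent to zero. -/
noncomputable def substClosed (a : Q.Fan j s) (p : Q.double.Path) : (Q.contract a).Polyvector :=
  if p.tgt = p.src then (Q.contract a).toPolyvector (a.substPath p) else 0

end Fan

section Homogeneous

variable {V E : Type*} {Q : ArrowQuiver V E}

theorem ofPath_mem_homogeneous (p : Q.double.Path) : ofPath p ∈ Q.homogeneous (dualCount p.word) :=
  Submodule.subset_span ⟨p, rfl, rfl⟩

theorem idem_mem_homogeneous (i : V) : idem Q.double i ∈ Q.homogeneous 0 :=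
  ofPath_mem_homogeneous (Path.trivial Q.double i)

theorem arrow_mem_homogeneous (x : E ⊕ E) : arrow Q.double x ∈ Q.homogeneous (dualCount [x]) :=
  ofPath_mem_homogeneous (Path.ofArrow Q.double x)

theorem one_mem_homogeneous [Fintype V] : (1 : Q.double.PathAlgebra) ∈ Q.homogeneous 0 :=
  sum_mem fun i _ => idem_mem_homogeneous i

variable [DecidableEq V] [Fintype V]

theorem mul_mem_homogeneous {x y : Q.double.PathAlgebra} {r t : ℕ} (hx : x ∈ Q.homogeneous r)
    (hy : y ∈ Q.homogeneous t) : x * y ∈ Q.homogeneous (r + t) := by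
  induction hx using Submodule.span_induction with
  | zero => simp
  | add x x' _ _ hx hx' => rw [add_mul]; exact add_mem hx hx'
  | smul c x _ hx => rw [smul_mul_eq]; exact Submodule.smul_mem _ _ hx
  | mem x hx =>
    obtain ⟨p, rfl, rfl⟩ := hx
    induction hy using Submodule.span_induction with
    | zero => simp
    | add x y _ _ hx hy => rw [mul_add]; exact add_mem hx hy
    | smul c x _ hx => rw [mul_smul_eq]; exact Submodule.smul_mem _ _ hx
    | mem y hy =>
      obtain ⟨q, rfl, rfl⟩ := hy
      rw [ofPath_mul_ofPath]
      split_ifs with h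
      · rw [← dualCount_append]
        exact ofPath_mem_homogeneous (p.comp q h)
      · exact zero_mem _

theorem toPolyvector_mul_comm {x y : Q.double.PathAlgebra} {r t : ℕ} (hx : x ∈ Q.homogeneous r)
    (hy : y ∈ Q.homogeneous t) :
    Q.toPolyvector (x * y) = (-1 : ℂ) ^ (r * t) • Q.toPolyvector (y * x) := by
  rw [← map_smul, ← sub_eq_zero, ← map_sub]
  exact (Submodule.Quotient.mk_eq_zero _).2 (Submodule.subset_span ⟨r, t, x, y, hx, hy, rfl⟩)

end Homogeneous

namespace Fan

variable [DecidableEq V] [Fintype V] [Fintype E]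

theorem split_mem (a : Q.Fan j s) (b : E) : a.split b ∈ (Q.contract a).homogeneous 0 :=
  sum_mem fun c _ => arrow_mem_homogeneous (Sum.inl c)

theorem splitDual_mem (a : Q.Fan j s) (b : E) : a.splitDual b ∈ (Q.contract a).homogeneous 1 :=
  sum_mem fun c _ => arrow_mem_homogeneous (Sum.inr c)

theorem dualValue_mem (a : Q.Fan j s) (m : Fin s) :
    a.dualValue m ∈ (Q.contract a).homogeneous 1 := by
  rw [← zero_add 1]
  refine Submodule.sub_mem _ ?_ ?_
  · refine mul_mem_homogeneous (idem_mem_homogeneous _) (Submodule.sum_mem _ fun b _ => ?_)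
    exact mul_mem_homogeneous (r := 1) (t := 0) (a.splitDual_mem b) (a.split_mem b)
  · refine mul_mem_homogeneous (idem_mem_homogeneous _) (Submodule.sum_mem _ fun b _ => ?_)
    exact mul_mem_homogeneous (r := 0) (t := 1) (a.split_mem b) (a.splitDual_mem b)

theorem substArrow_mem (a : Q.Fan j s) (x : E ⊕ E) :
    a.substArrow x ∈ (Q.contract a).homogeneous (dualCount [x]) := by
  cases x with
  | inl b =>
    simp only [substArrow]
    split_ifs
    · exact idem_mem_homogeneous _
    · exact a.split_mem b
  | inr b =>
    simp only [substArrow]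
    split_ifs
    · exact a.dualValue_mem _
    · exact a.splitDual_mem b

theorem prod_substArrow_mem (a : Q.Fan j s) (w : List (E ⊕ E)) :
    (w.map a.substArrow).prod ∈ (Q.contract a).homogeneous (dualCount w) := by
  induction w with
  | nil => exact one_mem_homogeneous
  | cons x w ih =>
    rw [List.map_cons, List.prod_cons, ← List.singleton_append, dualCount_append]
    exact mul_mem_homogeneous (a.substArrow_mem x) ih

theorem substPath_cons (a : Q.Fan j s) {p : Q.double.Path} (h : p.word ≠ []) :
    a.substPath p = (p.word.map a.substArrow).prod :=
  if_neg h

theorem substClosed_closed (a : Q.Fan j s) {p : Q.double.Path} (h : p.tgt = p.src) :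
    a.substClosed p = (Q.contract a).toPolyvector (a.substPath p) :=
  if_pos h

theorem substClosed_of_ne (a : Q.Fan j s) {p : Q.double.Path} (h : p.tgt ≠ p.src) :
    a.substClosed p = 0 :=
  if_neg h

theorem substClosed_comp (a : Q.Fan j s) (p r : Q.double.Path) (h1 : p.src = r.tgt)
    (h2 : r.src = p.tgt) :
    a.substClosed (p.comp r h1) =
      (-1 : ℂ) ^ (dualCount p.word * dualCount r.word) • a.substClosed (r.comp p h2) := by
  by_cases e1 : p.word = []
  · have : p.comp r h1 = r.comp p h2 := by
      have hp := p.isWalk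
      rw [e1] at hp
      have hp' : p.tgt = p.src := hp
      ext1
      · exact hp'.trans h1
      · simp [Path.comp, e1]
      · exact h2.trans hp'
    simp [this, e1, dualCount]
  by_cases e2 : r.word = []
  · have : p.comp r h1 = r.comp p h2 := by
      have hr := r.isWalk
      rw [e2] at hr
      have hr' : r.tgt = r.src := hr
      ext1
      · exact (hr'.trans h2).symm
      · simp [Path.comp, e2]
      · exact (h1.trans hr').symm
    simp [this, e2, dualCount]
  have k1 : (p.comp r h1).word ≠ [] := by simp [Path.comp, e1]
  have k2 : (r.comp p h2).word ≠ [] := by simp [Path.comp, e1]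
  rw [a.substClosed_closed (p := p.comp r h1) h2.symm,
    a.substClosed_closed (p := r.comp p h2) h1.symm, a.substPath_cons k1, a.substPath_cons k2]
  simp only [Path.comp, List.map_append, List.prod_append]
  exact toPolyvector_mul_comm (a.prod_substArrow_mem p.word) (a.prod_substArrow_mem r.word)

/-- The substitution on polyvector fields. -/
noncomputable def subst (a : Q.Fan j s) : Q.Polyvector →ₗ[ℂ] (Q.contract a).Polyvector :=
  Q.superCommutators.liftQ (lift a.substClosed) <| by
    refine superCommutators_le_ker _ fun p r => ?_
    rw [ofPath_mul_ofPath, ofPath_mul_ofPath]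
    by_cases h1 : p.src = r.tgt <;> by_cases h2 : r.src = p.tgt
    · rw [dif_pos h1, dif_pos h2, lift_ofPath, lift_ofPath]
      exact a.substClosed_comp p r h1 h2
    · rw [dif_pos h1, dif_neg h2, lift_ofPath,
        a.substClosed_of_ne (p := p.comp r h1) (Ne.symm h2), map_zero, smul_zero]
    · rw [dif_neg h1, dif_pos h2, lift_ofPath,
        a.substClosed_of_ne (p := r.comp p h2) (Ne.symm h1), map_zero, smul_zero]
    · rw [dif_neg h1, dif_neg h2, map_zero, smul_zero]

end Fan

end ArrowQuiver

/-! Write `φ` for the substitution on the path algebra of the double quiver (`evalSubst`). It is not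
a ring homomorphism, because the values of `e_j` and `e_{v_m}` are not orthogonal, but it is
multiplicative on composable paths, and this suffices for the products `D_{b*}(Π) D_b(Π)`. Since
`[Π, Π]` is twice the class of the sum of these products, it is enough that substitution carries
this sum to the corresponding sum for `Π'`, modulo supercommutators
(`toPolyvector_sum_superDeriv_subst`).

Let `B`, `B*` be the sums of the arrows `c_{b,i}`, respectively `c_{b,i}*`, over an arrow `b` other
than the `a_m`. Let `M` be the element `moment`, so that `a_m*` goes to `e_{v_m} M`, and put `Y = ∑
φ(D_{a_m*} Π) e_{v_m}`, summed over `m`. A chain rule for cyclic derivatives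
(`insertDeriv_prod_substArrow`) shows that, for `c` over `b` and up to the idempotents at the ends
of `c`, `D_c Π' = φ(D_b Π) + [t(b) = j] Y B* + [h(b) = j] B* Y`, `D_{c*} Π' = φ(D_{b*} Π) + [t(b) =
j] B Y - [h(b) = j] Y B`. Multiplying, summing over the `c` above `b` and rotating cyclically gives
`φ(D_{b*} Π) φ(D_b Π) + Y T_b`, where `T_b` is `vertexTerm`.

What is missing are the terms of the removed arrows `a_m`, and the `Y T_b` supply them. In any path
algebra of a double quiver the signed sum of `w D_w` over the arrows `w` ending at `j` equals the
sum of `D_w w` over those starting at `j`, on closed paths of even degree (`sum_mul_cyclicDeriv`).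
After substitution this reads `∑ T_b = ∑ e_{v_m} φ(D_{a_m} Π)` (`sum_vertexTerm`). As the `v_m` are
distinct, the `e_{v_m}` are orthogonal, so multiplication by `Y` on the left yields exactly `∑
φ(D_{a_m*} Π) φ(D_{a_m} Π)`. -/

namespace ArrowQuiver

open PathAlgebra

/-! ### Realizations of a quiver in a ring and cyclic derivatives of words -/

section CyclicDerivative

variable {V E A : Type*} [Ring A]

theorem dualCount_cons (x : E ⊕ E) (w : List (E ⊕ E)) :
    dualCount (x :: w) = dualCount [x] + dualCount w :=
  dualCount_append [x] w

theorem neg_one_pow_mul_self (n : ℕ) : (-1 : ℂ) ^ n * (-1 : ℂ) ^ n = 1 := by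
  rw [← mul_pow]; simp

/-- Values `f x` for the arrows of the double quiver and `e i` for its vertices, in a ring, such
that `e i` is an idempotent which acts as identity on the appropriate side of the `f x`. The `e i`
for different vertices need not be orthogonal. -/
structure IsRealization (Q : ArrowQuiver V E) (f : E ⊕ E → A) (e : V → A) : Prop where
  idem_mul : ∀ i, e i * e i = e i
  head_mul : ∀ x, e (Q.double.head x) * f x = f x
  mul_tail : ∀ x, f x * e (Q.double.tail x) = f x

section Walk

variable {Q : ArrowQuiver V E} {f : E ⊕ E → A} {e : V → A}

theorem idem_mul_prod (hf : IsRealization Q f e) {t s : V} {l : List (E ⊕ E)}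
    (hl : Q.double.IsWalk t l s) (h : l ≠ []) : e t * (l.map f).prod = (l.map f).prod := by
  cases l with
  | nil => exact absurd rfl h
  | cons x l => rw [List.map_cons, List.prod_cons, ← mul_assoc, ← hl.1, hf.head_mul]

/-- The factor `e t` is kept on both sides for the empty word, whose product is `1` instead of an
idempotent. -/
theorem idem_mul_prod_mul_idem (hf : IsRealization Q f e) {t s : V} {l : List (E ⊕ E)}
    (hl : Q.double.IsWalk t l s) : e t * (l.map f).prod * e s = e t * (l.map f).prod := by
  induction l generalizing t with
  | nil => cases hl; simp [hf.idem_mul]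
  | cons x l ih =>
    rw [List.map_cons, List.prod_cons, ← hf.mul_tail x, mul_assoc (f x), mul_assoc, mul_assoc,
      ih hl.2]

theorem prod_mul_prod (hf : IsRealization Q f e) {t s : V} {l : List (E ⊕ E)}
    (hl : Q.double.IsWalk t l s) (y : A) :
    e t * (l.map f).prod * (e s * y) = e t * (l.map f).prod * y := by
  rw [← mul_assoc, idem_mul_prod_mul_idem hf hl]

end Walk

variable [Module ℂ A] [IsScalarTower ℂ A A] [SMulCommClass ℂ A A]

open Classical in
/-- The cyclic derivative of a word with respect to the letter `w`: each occurrence `u w v`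
contributes `v z u`, with `z` inserted in the gap, and with the sign given by the number of dual
arrows in `u w`. -/
noncomputable def cyclicDeriv (Q : ArrowQuiver V E) (f : E ⊕ E → A) (e : V → A) (w : E ⊕ E) :
    List (E ⊕ E) → A →ₗ[ℂ] A
  | [] => 0
  | x :: v =>
    (if x = w then (-1 : ℂ) ^ dualCount [x] •
      (LinearMap.mulLeft ℂ (e (Q.double.tail x) * (v.map f).prod) ∘ₗ
        LinearMap.mulRight ℂ (e (Q.double.head x))) else 0) +
    -- A letter that has been passed is appended to `z`, so that `z` collects `z u` while the sign
    -- collects the degree of `u`.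
    (-1 : ℂ) ^ dualCount [x] • (cyclicDeriv Q f e w v ∘ₗ LinearMap.mulRight ℂ (f x))

variable {Q : ArrowQuiver V E} {f : E ⊕ E → A} {e : V → A}

@[simp]
theorem cyclicDeriv_nil (w : E ⊕ E) (z : A) : cyclicDeriv Q f e w [] z = 0 := rfl

open Classical in
theorem cyclicDeriv_cons (w x : E ⊕ E) (v : List (E ⊕ E)) (z : A) :
    cyclicDeriv Q f e w (x :: v) z =
      (if x = w then (-1 : ℂ) ^ dualCount [x] •
        (e (Q.double.tail x) * (v.map f).prod * z * e (Q.double.head x)) else 0) +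
      (-1 : ℂ) ^ dualCount [x] • cyclicDeriv Q f e w v (z * f x) := by
  rw [cyclicDeriv]
  split_ifs <;> simp [mul_assoc]

-- The unrolled recursion, in the shape of the terms of the superderivative.
open Classical in
theorem cyclicDeriv_eq_sum (w : E ⊕ E) (l : List (E ⊕ E)) (z : A) :
    cyclicDeriv Q f e w l z = ∑ i ∈ Finset.range l.length,
      if l[i]? = some w then (-1 : ℂ) ^ dualCount (l.take (i + 1)) •
        (e (Q.double.tail w) * ((l.drop (i + 1)).map f).prod * (z * ((l.take i).map f).prod) *
          e (Q.double.head w)) else 0 := by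
  induction l generalizing z with
  | nil => simp
  | cons x v ih =>
    rw [cyclicDeriv_cons, ih, List.length_cons, Finset.sum_range_succ', add_comm, Finset.smul_sum]
    congr 1
    · refine Finset.sum_congr rfl fun i _ => ?_
      simp only [List.getElem?_cons_succ, smul_ite, smul_zero, smul_smul, List.take_succ_cons,
        List.drop_succ_cons, dualCount_cons x (v.take (i + 1)),
        pow_add, List.map_cons, List.prod_cons, mul_assoc]
    · by_cases h : x = w
      · subst h
        simp
      · simp [h]

theorem cyclicDeriv_append (w : E ⊕ E) (u v : List (E ⊕ E)) (z : A) :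
    cyclicDeriv Q f e w (u ++ v) z = cyclicDeriv Q f e w u ((v.map f).prod * z) +
      (-1 : ℂ) ^ dualCount u • cyclicDeriv Q f e w v (z * (u.map f).prod) := by
  induction u generalizing z with
  | nil => simp [dualCount]
  | cons x u ih =>
    rw [List.cons_append, cyclicDeriv_cons, cyclicDeriv_cons, ih, dualCount_cons x u]
    simp only [smul_add, smul_smul, pow_add, List.map_append, List.prod_append, List.map_cons,
      List.prod_cons, mul_assoc, add_assoc]

theorem tail_mul_cyclicDeriv (hf : IsRealization Q f e) (w : E ⊕ E) (l : List (E ⊕ E)) (z : A) :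
    e (Q.double.tail w) * cyclicDeriv Q f e w l z = cyclicDeriv Q f e w l z := by
  induction l generalizing z with
  | nil => simp
  | cons x v ih =>
    rw [cyclicDeriv_cons, mul_add, mul_smul_comm, ih]
    congr 1
    split_ifs with h
    · subst h
      simp only [mul_smul_comm, ← mul_assoc, hf.idem_mul]
    · simp

theorem cyclicDeriv_mul_head (hf : IsRealization Q f e) (w : E ⊕ E) (l : List (E ⊕ E)) (z : A) :
    cyclicDeriv Q f e w l z * e (Q.double.head w) = cyclicDeriv Q f e w l z := by
  induction l generalizing z with
  | nil => simp
  | cons x v ih =>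
    rw [cyclicDeriv_cons, add_mul, smul_mul_assoc, ih]
    congr 1
    split_ifs with h
    · subst h
      simp only [smul_mul_assoc, mul_assoc, hf.idem_mul]
    · simp

variable [DecidableEq V] [Fintype E]

/-- A telescoping sum. An occurrence `u w v` contributes `± w v z u` to the first sum and `± v z u
w` to the second, so the second contribution of each letter cancels the first contribution of the
next one. Only the two ends of the path survive. -/
theorem sum_mul_cyclicDeriv (hf : IsRealization Q f e) (j : V) {t s : V} {l : List (E ⊕ E)}
    (hl : Q.double.IsWalk t l s) (z : A) :
    (∑ w, if Q.double.head w = j then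
        (-1 : ℂ) ^ dualCount [w] • (f w * cyclicDeriv Q f e w l z) else 0) -
      (∑ w, if Q.double.tail w = j then cyclicDeriv Q f e w l z * f w else 0) =
    (if t = j then e j * (l.map f).prod * z * e j else 0) -
      (if s = j then (-1 : ℂ) ^ dualCount l • (e j * z * (l.map f).prod * e j) else 0) := by
  classical
  induction l generalizing t z with
  | nil => cases hl; simp [dualCount]
  | cons x l ih =>
    obtain ⟨rfl, hl⟩ := hl
    have h1 : ∀ w, (if Q.double.head w = j then
        (-1 : ℂ) ^ dualCount [w] • (f w * cyclicDeriv Q f e w (x :: l) z) else 0) =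
        (if w = x then (if Q.double.head x = j then
          e j * ((x :: l).map f).prod * z * e j else 0) else 0) +
        (-1 : ℂ) ^ dualCount [x] • (if Q.double.head w = j then
          (-1 : ℂ) ^ dualCount [w] • (f w * cyclicDeriv Q f e w l (z * f x)) else 0) := by
      intro w
      rw [cyclicDeriv_cons]
      by_cases hw : w = x
      · subst hw
        by_cases hj : Q.double.head w = j
        · subst hj
          simp only [if_true, mul_add, smul_add, mul_smul_comm, smul_smul, neg_one_pow_mul_self,
            one_smul, ← mul_assoc, hf.mul_tail, List.map_cons, List.prod_cons, hf.head_mul]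
        · simp [hj]
      · have hw' : x ≠ w := fun h => hw h.symm
        rw [if_neg hw, if_neg hw', zero_add, zero_add, mul_smul_comm, smul_comm, smul_ite, smul_zero]
    have h2 : ∀ w, (if Q.double.tail w = j then cyclicDeriv Q f e w (x :: l) z * f w else 0) =
        (if w = x then (if Q.double.tail x = j then
          (-1 : ℂ) ^ dualCount [x] • (e j * (l.map f).prod * (z * f x) * e j) else 0) else 0) +
        (-1 : ℂ) ^ dualCount [x] • (if Q.double.tail w = j then
          cyclicDeriv Q f e w l (z * f x) * f w else 0) := by
      intro w
      rw [cyclicDeriv_cons]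
      by_cases hw : w = x
      · subst hw
        by_cases hj : Q.double.tail w = j
        · subst hj
          simp only [if_true, add_mul, smul_mul_assoc, mul_assoc, hf.mul_tail, hf.head_mul]
        · simp [hj]
      · have hw' : x ≠ w := fun h => hw h.symm
        split_ifs <;> simp [smul_mul_assoc]
    simp only [h1, h2, Finset.sum_add_distrib, Finset.sum_ite_eq', Finset.mem_univ, if_true,
      ← Finset.smul_sum]
    -- The boundary term at the tail of `x`, from the induction hypothesis for `z * f x`, cancels
    -- the extra summand in `h2`.
    have h3 := congrArg (fun y => (-1 : ℂ) ^ dualCount [x] • y) (ih hl (z * f x))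
    simp only [smul_sub, smul_ite, smul_zero, smul_smul, ← pow_add, ← dualCount_cons] at h3
    simp only [List.map_cons, List.prod_cons, mul_assoc] at h3 ⊢
    rw [add_sub_add_comm, h3]
    abel

end CyclicDerivative

/-! ### Evaluation of paths in a realization -/

section

variable {V E A : Type*} [Ring A] [Module ℂ A] [IsScalarTower ℂ A A] [SMulCommClass ℂ A A]
  {Q : ArrowQuiver V E} {f : E ⊕ E → A} {e : V → A}

/-- In `v z u` the factor to the left of `z` ends at the source of the path, even if `v` is empty,
thanks to the idempotent put in front of `v`. -/
theorem cyclicDeriv_idem_mul (hf : IsRealization Q f e) (w : E ⊕ E) {t s : V} {l : List (E ⊕ E)}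
    (hl : Q.double.IsWalk t l s) (z : A) :
    cyclicDeriv Q f e w l (e s * z) = cyclicDeriv Q f e w l z := by
  induction l generalizing t z with
  | nil => simp
  | cons x l ih =>
    rw [cyclicDeriv_cons, cyclicDeriv_cons, prod_mul_prod hf hl.2, mul_assoc (e s), ih hl.2]

theorem cyclicDeriv_mul_idem (hf : IsRealization Q f e) (w : E ⊕ E) {t s : V} {l : List (E ⊕ E)}
    (hl : Q.double.IsWalk t l s) (z : A) :
    cyclicDeriv Q f e w l (z * e t) = cyclicDeriv Q f e w l z := by
  cases l with
  | nil => simp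
  | cons x l =>
    obtain ⟨rfl, -⟩ := hl
    rw [cyclicDeriv_cons, cyclicDeriv_cons, mul_assoc z, hf.head_mul, ← mul_assoc _ z,
      mul_assoc (_ * z), hf.idem_mul]

theorem IsWalk.of_getElem? {t s : V} {l : List E} {R : ArrowQuiver V E} (hl : R.IsWalk t l s)
    {i : ℕ} {w : E} (h : l[i]? = some w) :
    R.IsWalk t (l.take i) (R.head w) ∧ R.IsWalk (R.tail w) (l.drop (i + 1)) s := by
  induction l generalizing t i with
  | nil => simp at h
  | cons x l ih =>
    cases i with
    | zero =>
      simp only [List.getElem?_cons_zero, Option.some.injEq] at h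
      subst h
      exact ⟨hl.1.symm, hl.2⟩
    | succ i =>
      obtain ⟨h1, h2⟩ := ih hl.2 (i := i) (by simpa using h)
      exact ⟨⟨hl.1, h1⟩, h2⟩

/-- The linear map on the path algebra given by multiplying out the values of the arrows. -/
noncomputable def evalPath (Q : ArrowQuiver V E) (f : E ⊕ E → A) (e : V → A) :
    Q.double.PathAlgebra →ₗ[ℂ] A :=
  lift fun p => e p.tgt * (p.word.map f).prod

theorem evalPath_ofPath (p : Q.double.Path) :
    evalPath Q f e (ofPath p) = e p.tgt * (p.word.map f).prod :=
  lift_ofPath _ p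

theorem evalPath_ofPath_of_ne (hf : IsRealization Q f e) {p : Q.double.Path} (h : p.word ≠ []) :
    evalPath Q f e (ofPath p) = (p.word.map f).prod := by
  rw [evalPath_ofPath, idem_mul_prod hf p.isWalk h]

theorem evalPath_comp (hf : IsRealization Q f e) (p q : Q.double.Path) (h : p.src = q.tgt) :
    evalPath Q f e (ofPath (p.comp q h)) =
      evalPath Q f e (ofPath p) * evalPath Q f e (ofPath q) := by
  simp only [evalPath_ofPath, ← h]
  rw [prod_mul_prod hf p.isWalk, mul_assoc, ← List.prod_append, ← List.map_append]
  rfl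

end

/-! ### Superderivatives as cyclic derivatives with `1` inserted -/

section PathAlgebra

variable {V E : Type*} [DecidableEq V] [Fintype V]

instance (Q : ArrowQuiver V E) : IsScalarTower ℂ Q.PathAlgebra Q.PathAlgebra :=
  ⟨smul_mul_eq⟩

instance (Q : ArrowQuiver V E) : SMulCommClass ℂ Q.PathAlgebra Q.PathAlgebra :=
  ⟨fun c x y => (mul_smul_eq c x y).symm⟩

variable {Q : ArrowQuiver V E}

theorem idem_mul_idem (i k : V) : idem Q i * idem Q k = if i = k then idem Q i else 0 := by
  unfold idem
  rw [trivial_mul]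
  by_cases h : i = k
  · subst h; rfl
  · rw [if_neg h, if_neg (show ¬ i = (Path.trivial Q k).tgt from h)]

theorem idem_mul_self (i : V) : idem Q i * idem Q i = idem Q i := by
  rw [idem_mul_idem, if_pos rfl]

theorem idem_mul_arrow (x : E) : idem Q (Q.head x) * arrow Q x = arrow Q x :=
  (trivial_mul _ _).trans (if_pos rfl)

theorem arrow_mul_idem (x : E) : arrow Q x * idem Q (Q.tail x) = arrow Q x :=
  (mul_trivial _ _).trans (if_pos rfl)

theorem isRealization_arrow (Q : ArrowQuiver V E) :
    IsRealization Q (arrow Q.double) (idem Q.double) :=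
  ⟨idem_mul_self, idem_mul_arrow, arrow_mul_idem⟩

theorem idem_mul_prod_arrow (p : Q.Path) :
    idem Q p.tgt * (p.word.map (arrow Q)).prod = ofPath p := by
  obtain ⟨t, w, s, hw⟩ := p
  induction w generalizing t with
  | nil => cases hw; simp [idem, Path.trivial]
  | cons x w ih =>
    obtain ⟨rfl, hw⟩ := hw
    have h := ih _ hw
    simp only [List.map_cons, List.prod_cons] at h ⊢
    rw [← mul_assoc, idem_mul_arrow, ← arrow_mul_idem, mul_assoc, h]
    exact (ofPath_mul_ofPath _ _).trans (dif_pos rfl)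

theorem evalPath_arrow (x : Q.double.PathAlgebra) :
    evalPath Q (arrow Q.double) (idem Q.double) x = x := by
  suffices h : evalPath Q (arrow Q.double) (idem Q.double) = LinearMap.id by rw [h]; rfl
  exact hom_ext fun p => (evalPath_ofPath p).trans (idem_mul_prod_arrow p)

/-- The span of the paths from the vertex `k` to the vertex `i`. -/
noncomputable def corner (Q : ArrowQuiver V E) (i k : V) : Submodule ℂ Q.PathAlgebra :=
  Submodule.span ℂ {x | ∃ p : Q.Path, p.tgt = i ∧ p.src = k ∧ x = ofPath p}

theorem exists_path_of_superDerivTerm (w : E ⊕ E) {p : Q.double.Path} (hp : p.tgt = p.src)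
    (i : ℕ) (hi : p.word[i]? = some w) :
    ∃ q : Q.double.Path, q.tgt = Q.double.tail w ∧ q.src = Q.double.head w ∧
      q.word = p.word.drop (i + 1) ++ p.word.take i ∧
      Q.superDerivTerm w p.word i =
        (-1 : ℂ) ^ (dualCount (p.word.drop (i + 1)) * dualCount (p.word.take (i + 1))) •
          ofPath q := by
  obtain ⟨h1, h2⟩ := p.isWalk.of_getElem? hi
  refine ⟨⟨_, _, _, h2.append (hp ▸ h1)⟩, rfl, rfl, rfl, ?_⟩
  rw [superDerivTerm, if_pos hi, ← idem_mul_prod_arrow]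

theorem superDerivPath_mem_corner (w : E ⊕ E) (p : Q.double.Path) :
    Q.superDerivPath w p ∈ corner Q.double (Q.double.tail w) (Q.double.head w) := by
  by_cases hp : p.tgt = p.src
  · rw [superDerivPath_closed _ _ hp]
    refine sum_mem fun i _ => ?_
    by_cases hi : p.word[i]? = some w
    · obtain ⟨q, h1, h2, -, h⟩ := exists_path_of_superDerivTerm w hp i hi
      rw [h]
      exact Submodule.smul_mem _ _ (Submodule.subset_span ⟨q, h1, h2, rfl⟩)
    · rw [superDerivTerm, if_neg hi]
      exact zero_mem _
  · rw [superDerivPath_of_ne _ _ hp]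
    exact zero_mem _

theorem superDeriv_mem_corner (w : E ⊕ E) (P : Q.Polyvector) :
    Q.superDeriv w P ∈ corner Q.double (Q.double.tail w) (Q.double.head w) := by
  obtain ⟨x, rfl⟩ := Submodule.mkQ_surjective _ P
  induction x using PathAlgebra.induction_on with
  | h0 => simp
  | hadd x y hx hy => rw [map_add, map_add]; exact add_mem hx hy
  | hsmul c p =>
    rw [map_smul, map_smul]
    refine Submodule.smul_mem _ _ ?_
    convert superDerivPath_mem_corner w p
    exact lift_ofPath _ p

theorem superDeriv_toPolyvector (w : E ⊕ E) (p : Q.double.Path) :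
    Q.superDeriv w (Q.toPolyvector (ofPath p)) = Q.superDerivPath w p :=
  lift_ofPath _ p

/-- `m` and `n` have the same parity, hence so have `m * n` and `n`. This reconciles the two sign
conventions for derivatives in even degree. -/
theorem neg_one_pow_mul_of_add_eq {m n r : ℕ} (h : m + n = 2 * r) :
    (-1 : ℂ) ^ (m * n) = (-1) ^ n := by
  rcases Nat.even_or_odd n with hn | hn
  · rw [hn.neg_one_pow, (hn.mul_left m).neg_one_pow]
  · have hm : Odd m := by
      by_contra hm
      rw [Nat.not_odd_iff_even] at hm
      have := hm.add_odd hn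
      rw [h] at this
      exact absurd (even_two_mul r) (Nat.not_even_iff_odd.2 this)
    rw [hn.neg_one_pow, (hm.mul hn).neg_one_pow]

variable {A : Type*} [Ring A] [Module ℂ A] [IsScalarTower ℂ A A] [SMulCommClass ℂ A A]
  {f : E ⊕ E → A} {e : V → A}

theorem evalPath_superDerivPath (hf : IsRealization Q f e) (w : E ⊕ E) {p : Q.double.Path}
    (hp : p.tgt = p.src) {r : ℕ} (hr : dualCount p.word = 2 * r) :
    evalPath Q f e (Q.superDerivPath w p) = cyclicDeriv Q f e w p.word 1 := by
  rw [superDerivPath_closed _ _ hp, map_sum, cyclicDeriv_eq_sum]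
  refine Finset.sum_congr rfl fun i _ => ?_
  split_ifs with hi
  · obtain ⟨q, h1, h2, h3, h⟩ := exists_path_of_superDerivTerm w hp i hi
    rw [h, map_smul, neg_one_pow_mul_of_add_eq (r := r), evalPath_ofPath, ← h1, ← h2, one_mul,
      mul_assoc (e q.tgt), ← List.prod_append, ← List.map_append, ← h3,
      idem_mul_prod_mul_idem hf q.isWalk]
    rw [add_comm, ← dualCount_append, List.take_append_drop, hr]
  · rw [superDerivTerm, if_neg hi, map_zero]

/-- The cyclic derivative as a linear map on the path algebra: each occurrence of the arrow `w` in a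
path `u w v` contributes `v z u`, up to sign. -/
noncomputable def insertDeriv (Q : ArrowQuiver V E) (w : E ⊕ E) :
    Q.double.PathAlgebra →ₗ[ℂ] Q.double.PathAlgebra →ₗ[ℂ] Q.double.PathAlgebra :=
  lift fun p => cyclicDeriv Q (arrow Q.double) (idem Q.double) w p.word

theorem insertDeriv_ofPath (w : E ⊕ E) (p : Q.double.Path) :
    insertDeriv Q w (ofPath p) = cyclicDeriv Q (arrow Q.double) (idem Q.double) w p.word :=
  lift_ofPath _ p

theorem insertDeriv_idem (w : E ⊕ E) (i : V) (z : Q.double.PathAlgebra) :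
    insertDeriv Q w (idem Q.double i) z = 0 := by
  rw [idem, insertDeriv_ofPath]; rfl

open Classical in
theorem insertDeriv_arrow (w x : E ⊕ E) (z : Q.double.PathAlgebra) :
    insertDeriv Q w (arrow Q.double x) z = if x = w then (-1 : ℂ) ^ dualCount [x] •
      (idem Q.double (Q.double.tail x) * z * idem Q.double (Q.double.head x)) else 0 := by
  rw [arrow, insertDeriv_ofPath]
  exact (cyclicDeriv_cons _ _ _ _).trans (by simp)

/-- The Leibniz rule is the reason for inserting an element `z`: differentiating one factor inserts
the other next to `z`, on the side prescribed by cyclic order. -/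
theorem insertDeriv_mul_path (w : E ⊕ E) (p q : Q.double.Path) (z : Q.double.PathAlgebra) :
    insertDeriv Q w (ofPath p * ofPath q) z = insertDeriv Q w (ofPath p) (ofPath q * z) +
      (-1 : ℂ) ^ dualCount p.word • insertDeriv Q w (ofPath q) (z * ofPath p) := by
  have hf := isRealization_arrow Q
  have hp := evalPath_arrow (ofPath p)
  have hq := evalPath_arrow (ofPath q)
  rw [evalPath_ofPath] at hp hq
  rw [ofPath_mul_ofPath, insertDeriv_ofPath, insertDeriv_ofPath]
  split_ifs with h
  · rw [insertDeriv_ofPath, Path.comp, cyclicDeriv_append]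
    congr 1
    · rw [← hq, ← h, mul_assoc, cyclicDeriv_idem_mul hf w p.isWalk]
    · congr 1
      -- The list product of a trivial path is `1`, not its idempotent; the difference is absorbed
      -- at the target of `q`.
      by_cases hw : p.word = []
      · have ht : p.tgt = q.tgt := by
          have := p.isWalk
          rw [hw] at this
          exact Eq.trans this h
        rw [← hp, hw, ht]
        simp [cyclicDeriv_mul_idem hf w q.isWalk]
      · rw [← hp, idem_mul_prod hf p.isWalk hw]
  -- If the paths are not composable, the idempotents that may be inserted next to `q` and `p`
  -- annihilate both terms on the right.
  · rw [← cyclicDeriv_idem_mul hf w p.isWalk, ← cyclicDeriv_mul_idem hf w q.isWalk, ← mul_assoc,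
      mul_assoc z]
    simp only [idem]
    rw [trivial_mul, if_neg h, mul_trivial, if_neg (Ne.symm h)]
    simp

theorem insertDeriv_mul (w : E ⊕ E) {x : Q.double.PathAlgebra} {r : ℕ} (hx : x ∈ Q.homogeneous r)
    (y z : Q.double.PathAlgebra) :
    insertDeriv Q w (x * y) z = insertDeriv Q w x (y * z) +
      (-1 : ℂ) ^ r • insertDeriv Q w y (z * x) := by
  induction hx using Submodule.span_induction with
  | zero => simp
  | add x x' _ _ hx hx' =>
    simp only [add_mul, mul_add, map_add, LinearMap.add_apply, smul_add, hx, hx']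
    abel
  | smul c x _ hx =>
    simp only [smul_mul_assoc, mul_smul_comm, map_smul, LinearMap.smul_apply, hx, smul_add]
    rw [smul_comm c]
  | mem x hx =>
    obtain ⟨p, rfl, rfl⟩ := hx
    induction y using PathAlgebra.induction_on with
    | h0 => simp
    | hadd y y' hy hy' =>
      simp only [add_mul, mul_add, map_add, LinearMap.add_apply, smul_add, hy, hy']
      abel
    | hsmul c q =>
      simp only [smul_mul_assoc, mul_smul_comm, map_smul, LinearMap.smul_apply,
        insertDeriv_mul_path, smul_add]
      rw [smul_comm c]

theorem superDeriv_eq_insertDeriv (w : E ⊕ E) {r : ℕ} {x : Q.double.PathAlgebra}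
    (hx : x ∈ Q.homogeneous (2 * r)) :
    Q.superDeriv w (Q.toPolyvector x) = insertDeriv Q w x 1 := by
  induction hx using Submodule.span_induction with
  | zero => simp
  | add x x' _ _ hx hx' => rw [map_add, map_add, map_add, hx, hx', LinearMap.add_apply]
  | smul c x _ hx => rw [map_smul, map_smul, map_smul, hx, LinearMap.smul_apply]
  | mem x hx =>
    obtain ⟨p, hp, rfl⟩ := hx
    rw [superDeriv_toPolyvector, insertDeriv_ofPath]
    by_cases h : p.tgt = p.src
    · rw [← evalPath_superDerivPath (isRealization_arrow Q) w h hp, evalPath_arrow]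
    -- For a path that is not closed, the inserted `1` may be replaced by a product of two
    -- orthogonal idempotents.
    · rw [superDerivPath_of_ne _ _ h, ← cyclicDeriv_idem_mul (isRealization_arrow Q) w p.isWalk,
        ← cyclicDeriv_mul_idem (isRealization_arrow Q) w p.isWalk, mul_one, idem_mul_idem,
        if_neg (Ne.symm h), map_zero]

/-- The degree is stated additively to avoid truncated subtraction. -/
theorem cyclicDeriv_mem_homogeneous {V' E' : Type*} {R : ArrowQuiver V' E'} [DecidableEq V']
    [Fintype V'] {f : E ⊕ E → R.double.PathAlgebra} {e : V → R.double.PathAlgebra}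
    (hf : ∀ x, f x ∈ R.homogeneous (dualCount [x])) (he : ∀ i, e i ∈ R.homogeneous 0)
    (w : E ⊕ E) (l : List (E ⊕ E)) {z : R.double.PathAlgebra} {r d : ℕ}
    (hz : z ∈ R.homogeneous r) (hd : dualCount l + r = d + dualCount [w]) :
    cyclicDeriv Q f e w l z ∈ R.homogeneous d := by
  induction l generalizing z r with
  | nil => exact zero_mem _
  | cons x l ih =>
    rw [cyclicDeriv_cons]
    rw [dualCount_cons] at hd
    refine add_mem ?_ (Submodule.smul_mem _ _ (ih (mul_mem_homogeneous hz (hf x)) (by omega)))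
    split_ifs with h
    · subst h
      have hl : (l.map f).prod ∈ R.homogeneous (dualCount l) := by
        clear hd ih
        induction l with
        | nil => exact one_mem_homogeneous
        | cons x l ih =>
          rw [List.map_cons, List.prod_cons, dualCount_cons]
          exact mul_mem_homogeneous (hf x) ih
      refine Submodule.smul_mem _ _ ?_
      have := mul_mem_homogeneous (mul_mem_homogeneous (mul_mem_homogeneous
        (he (Q.double.tail x)) hl) hz) (he (Q.double.head x))
      rwa [show 0 + dualCount l + r + 0 = d by omega] at this
    · exact zero_mem _

end PathAlgebra

/-- For `r = s = 2` the sign `(-1)^((r-1)(s-1))` is `-1`, so both halves of the bracket agree. -/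
theorem schouten_two_two {V E : Type*} [DecidableEq V] [Fintype V] [Fintype E]
    (Q : ArrowQuiver V E) (P : Q.Polyvector) :
    Q.schouten 2 2 P P = (2 : ℂ) • Q.toPolyvector
      (∑ b : E, Q.superDeriv (Sum.inr b) P * Q.superDeriv (Sum.inl b) P) := by
  rw [schouten, ← map_smul, Finset.smul_sum]
  congr 1
  refine Finset.sum_congr rfl fun b _ => ?_
  norm_num
  rw [two_smul]

/-! ### The substitution as a realization -/

namespace Fan

variable {V E : Type*} {Q : ArrowQuiver V E} {j : V} {s : ℕ}

theorem arr_injective (a : Q.Fan j s) : Function.Injective a.arr := fun m n h =>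
  a.tail_injective (congrArg Q.tail h)

theorem vertex_injective (a : Q.Fan j s) : Function.Injective a.vertex := fun _ _ h =>
  a.tail_injective (congrArg Subtype.val h)

theorem Arrow.base_notMem {a : Q.Fan j s} (c : a.Arrow) : c.base ∉ Set.range a.arr := by
  cases c with
  | keep b hh ht => rintro ⟨m, rfl⟩; exact hh (a.head_arr m)
  | outgoing b hh ht m => rintro ⟨m, rfl⟩; exact hh (a.head_arr m)
  | incoming b hh ht hb m => exact hb
  | loop b hh ht m n => rintro ⟨m, rfl⟩; exact a.tail_ne m ht

theorem notMem_of_tail (a : Q.Fan j s) {b : E} (h : Q.tail b = j) : b ∉ Set.range a.arr := by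
  rintro ⟨m, rfl⟩
  exact a.tail_ne m h

variable [DecidableEq V]

section

variable [Fintype E]

open Classical in
theorem sum_eq_sum_arr_add {M : Type*} [AddCommGroup M] (a : Q.Fan j s) (F : E → M) :
    ∑ b, F b = ∑ m, F (a.arr m) + ∑ b with b ∉ Set.range a.arr, F b := by
  rw [← Finset.sum_filter_add_sum_filter_not Finset.univ (fun b => b ∈ Set.range a.arr) F]
  congr 1
  rw [show Finset.univ.filter (fun b => b ∈ Set.range a.arr) = Finset.univ.image a.arr by
    ext b; simp, Finset.sum_image fun _ _ _ _ h => a.arr_injective h]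

end

variable [Fintype V]

theorem substVertex_self (a : Q.Fan j s) :
    a.substVertex j = ∑ m, idem (Q.contract a).double (a.vertex m) :=
  dif_pos rfl

theorem substVertex_of_ne (a : Q.Fan j s) {i : V} (h : i ≠ j) :
    a.substVertex i = idem (Q.contract a).double ⟨i, h⟩ :=
  dif_neg h

theorem substVertex_mem (a : Q.Fan j s) (i : V) :
    a.substVertex i ∈ (Q.contract a).homogeneous 0 := by
  by_cases h : i = j
  · subst h
    rw [a.substVertex_self]
    exact sum_mem fun m _ => idem_mem_homogeneous _
  · rw [a.substVertex_of_ne h]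
    exact idem_mem_homogeneous _

theorem substVertex_mul_idem_vertex (a : Q.Fan j s) (m : Fin s) :
    a.substVertex j * idem _ (a.vertex m) = idem _ (a.vertex m) := by
  simp [a.substVertex_self, Finset.sum_mul, idem_mul_idem, a.vertex_injective.eq_iff]

theorem idem_vertex_mul_substVertex (a : Q.Fan j s) (m : Fin s) :
    idem _ (a.vertex m) * a.substVertex j = idem _ (a.vertex m) := by
  simp [a.substVertex_self, Finset.mul_sum, idem_mul_idem, a.vertex_injective.eq_iff]

theorem substVertex_mul_self (a : Q.Fan j s) (i : V) :
    a.substVertex i * a.substVertex i = a.substVertex i := by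
  by_cases h : i = j
  · subst h
    nth_rw 2 3 [a.substVertex_self]
    simp [Finset.mul_sum, substVertex_mul_idem_vertex]
  · rw [a.substVertex_of_ne h, idem_mul_self]

theorem substVertex_mul_idem_head (a : Q.Fan j s) (c : a.Arrow) :
    a.substVertex (Q.head c.base) * idem _ ((Q.contract a).head c) =
      idem _ ((Q.contract a).head c) := by
  cases c with
  | keep b hh ht => exact (congrArg (· * _) (a.substVertex_of_ne hh)).trans (idem_mul_self _)
  | outgoing b hh ht m =>
    exact (congrArg (· * _) (a.substVertex_of_ne hh)).trans (idem_mul_self _)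
  | incoming b hh ht hb m =>
    exact (congrArg (a.substVertex · * _) hh).trans (a.substVertex_mul_idem_vertex m)
  | loop b hh ht m n =>
    exact (congrArg (a.substVertex · * _) hh).trans (a.substVertex_mul_idem_vertex m)

theorem substVertex_mul_idem_tail (a : Q.Fan j s) (c : a.Arrow) :
    a.substVertex (Q.tail c.base) * idem _ ((Q.contract a).tail c) =
      idem _ ((Q.contract a).tail c) := by
  cases c with
  | keep b hh ht => exact (congrArg (· * _) (a.substVertex_of_ne ht)).trans (idem_mul_self _)
  | outgoing b hh ht m =>
    exact (congrArg (a.substVertex · * _) ht).trans (a.substVertex_mul_idem_vertex m)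
  | incoming b hh ht hb m =>
    exact (congrArg (· * _) (a.substVertex_of_ne ht)).trans (idem_mul_self _)
  | loop b hh ht m n =>
    exact (congrArg (a.substVertex · * _) ht).trans (a.substVertex_mul_idem_vertex n)

theorem idem_head_mul_substVertex (a : Q.Fan j s) (c : a.Arrow) :
    idem _ ((Q.contract a).head c) * a.substVertex (Q.head c.base) =
      idem _ ((Q.contract a).head c) := by
  cases c with
  | keep b hh ht => exact (congrArg (_ * ·) (a.substVertex_of_ne hh)).trans (idem_mul_self _)
  | outgoing b hh ht m =>
    exact (congrArg (_ * ·) (a.substVertex_of_ne hh)).trans (idem_mul_self _)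
  | incoming b hh ht hb m =>
    exact (congrArg (_ * a.substVertex ·) hh).trans (a.idem_vertex_mul_substVertex m)
  | loop b hh ht m n =>
    exact (congrArg (_ * a.substVertex ·) hh).trans (a.idem_vertex_mul_substVertex m)

theorem idem_tail_mul_substVertex (a : Q.Fan j s) (c : a.Arrow) :
    idem _ ((Q.contract a).tail c) * a.substVertex (Q.tail c.base) =
      idem _ ((Q.contract a).tail c) := by
  cases c with
  | keep b hh ht => exact (congrArg (_ * ·) (a.substVertex_of_ne ht)).trans (idem_mul_self _)
  | outgoing b hh ht m =>
    exact (congrArg (_ * a.substVertex ·) ht).trans (a.idem_vertex_mul_substVertex m)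
  | incoming b hh ht hb m =>
    exact (congrArg (_ * ·) (a.substVertex_of_ne ht)).trans (idem_mul_self _)
  | loop b hh ht m n =>
    exact (congrArg (_ * a.substVertex ·) ht).trans (a.idem_vertex_mul_substVertex n)

variable [Fintype E]

-- The arrows over `b` correspond to all choices of one vertex over `h(b)` and one over `t(b)`,
-- where the vertices over `j` are the `v_m`. The four cases match the four constructors of
-- `Fan.Arrow`.
open Classical in
theorem sum_idem_mul_mul_idem (a : Q.Fan j s) {b : E} (hb : b ∉ Set.range a.arr)
    (x : (Q.contract a).double.PathAlgebra) :
    ∑ c : a.Arrow with c.base = b,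
      idem _ ((Q.contract a).head c) * x * idem _ ((Q.contract a).tail c) =
    a.substVertex (Q.head b) * x * a.substVertex (Q.tail b) := by
  by_cases hh : Q.head b = j <;> by_cases ht : Q.tail b = j
  · have : (Finset.univ.filter fun c : a.Arrow => c.base = b) =
        (Finset.univ : Finset (Fin s × Fin s)).image fun p => Arrow.loop b hh ht p.1 p.2 := by
      ext c
      simp only [Finset.mem_filter, Finset.mem_univ, true_and, Finset.mem_image]
      constructor
      · rintro rfl
        cases c with
        | keep b hh' ht' => exact absurd hh hh'
        | outgoing b hh' ht' m => exact absurd hh hh'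
        | incoming b hh' ht' hb' m => exact absurd ht ht'
        | loop b hh' ht' m n => exact ⟨(m, n), rfl⟩
      · rintro ⟨p, rfl⟩
        rfl
    rw [this, Finset.sum_image fun p _ q _ h => by cases p; cases q; simp_all,
      Fintype.sum_prod_type, hh, ht, a.substVertex_self]
    simp only [Finset.sum_mul, Finset.mul_sum]
    exact Finset.sum_comm
  · have : (Finset.univ.filter fun c : a.Arrow => c.base = b) =
        (Finset.univ : Finset (Fin s)).image fun m => Arrow.incoming b hh ht hb m := by
      ext c
      simp only [Finset.mem_filter, Finset.mem_univ, true_and, Finset.mem_image]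
      constructor
      · rintro rfl
        cases c with
        | keep b hh' ht' => exact absurd hh hh'
        | outgoing b hh' ht' m => exact absurd hh hh'
        | incoming b hh' ht' hb' m => exact ⟨m, rfl⟩
        | loop b hh' ht' m n => exact absurd ht' ht
      · rintro ⟨p, rfl⟩
        rfl
    rw [this, Finset.sum_image fun p _ q _ h => by simp_all, hh, a.substVertex_self,
      a.substVertex_of_ne ht]
    simp only [Finset.sum_mul]
    rfl
  · have : (Finset.univ.filter fun c : a.Arrow => c.base = b) =
        (Finset.univ : Finset (Fin s)).image fun m => Arrow.outgoing b hh ht m := by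
      ext c
      simp only [Finset.mem_filter, Finset.mem_univ, true_and, Finset.mem_image]
      constructor
      · rintro rfl
        cases c with
        | keep b hh' ht' => exact absurd ht ht'
        | outgoing b hh' ht' m => exact ⟨m, rfl⟩
        | incoming b hh' ht' hb' m => exact absurd hh' hh
        | loop b hh' ht' m n => exact absurd hh' hh
      · rintro ⟨p, rfl⟩
        rfl
    rw [this, Finset.sum_image fun p _ q _ h => by simp_all, ht, a.substVertex_self,
      a.substVertex_of_ne hh]
    simp only [Finset.mul_sum]
    rfl
  · have : (Finset.univ.filter fun c : a.Arrow => c.base = b) = {Arrow.keep b hh ht} := by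
      ext c
      simp only [Finset.mem_filter, Finset.mem_univ, true_and, Finset.mem_singleton]
      constructor
      · rintro rfl
        cases c with
        | keep b hh' ht' => rfl
        | outgoing b hh' ht' m => exact absurd ht' ht
        | incoming b hh' ht' hb' m => exact absurd hh' hh
        | loop b hh' ht' m n => exact absurd hh' hh
      · rintro rfl
        rfl
    rw [this, Finset.sum_singleton, a.substVertex_of_ne hh, a.substVertex_of_ne ht]
    rfl

theorem substVertex_mul_split (a : Q.Fan j s) {b : E} {i : V} (h : Q.head b = i) :
    a.substVertex i * a.split b = a.split b := by
  rw [split, Finset.mul_sum]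
  refine Finset.sum_congr rfl fun c hc => ?_
  obtain rfl : c.base = b := by simpa using hc
  rw [← h, ← idem_mul_arrow, ← mul_assoc]
  exact congrArg (· * _) (a.substVertex_mul_idem_head c)

theorem split_mul_substVertex (a : Q.Fan j s) {b : E} {i : V} (h : Q.tail b = i) :
    a.split b * a.substVertex i = a.split b := by
  rw [split, Finset.sum_mul]
  refine Finset.sum_congr rfl fun c hc => ?_
  obtain rfl : c.base = b := by simpa using hc
  rw [← h, ← arrow_mul_idem, mul_assoc]
  exact congrArg (_ * ·) (a.idem_tail_mul_substVertex c)

theorem substVertex_mul_splitDual (a : Q.Fan j s) {b : E} {i : V} (h : Q.tail b = i) :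
    a.substVertex i * a.splitDual b = a.splitDual b := by
  rw [splitDual, Finset.mul_sum]
  refine Finset.sum_congr rfl fun c hc => ?_
  obtain rfl : c.base = b := by simpa using hc
  rw [← h, ← idem_mul_arrow, ← mul_assoc]
  exact congrArg (· * _) (a.substVertex_mul_idem_tail c)

theorem splitDual_mul_substVertex (a : Q.Fan j s) {b : E} {i : V} (h : Q.head b = i) :
    a.splitDual b * a.substVertex i = a.splitDual b := by
  rw [splitDual, Finset.sum_mul]
  refine Finset.sum_congr rfl fun c hc => ?_
  obtain rfl : c.base = b := by simpa using hc
  rw [← h, ← arrow_mul_idem, mul_assoc]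
  exact congrArg (_ * ·) (a.idem_head_mul_substVertex c)

theorem substArrow_inl_arr (a : Q.Fan j s) (m : Fin s) :
    a.substArrow (Sum.inl (a.arr m)) = idem _ (a.vertex m) := by
  have h : ∃ n, a.arr n = a.arr m := ⟨m, rfl⟩
  exact (dif_pos h).trans (by rw [a.arr_injective h.choose_spec])

theorem substArrow_inr_arr (a : Q.Fan j s) (m : Fin s) :
    a.substArrow (Sum.inr (a.arr m)) = a.dualValue m := by
  have h : ∃ n, a.arr n = a.arr m := ⟨m, rfl⟩
  exact (dif_pos h).trans (by rw [a.arr_injective h.choose_spec])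

theorem substArrow_inl (a : Q.Fan j s) {b : E} (hb : b ∉ Set.range a.arr) :
    a.substArrow (Sum.inl b) = a.split b :=
  dif_neg hb

theorem substArrow_inr (a : Q.Fan j s) {b : E} (hb : b ∉ Set.range a.arr) :
    a.substArrow (Sum.inr b) = a.splitDual b :=
  dif_neg hb

open Classical in
/-- The part of the moment element at `j` of the arrows other than the `a_m`, after
substitution and with a minus sign. -/
noncomputable def moment (a : Q.Fan j s) : (Q.contract a).double.PathAlgebra :=
  (∑ b : E with Q.tail b = j, a.splitDual b * a.split b) -
    ∑ b : E with Q.head b = j ∧ b ∉ Set.range a.arr, a.split b * a.splitDual b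

theorem dualValue_eq (a : Q.Fan j s) (m : Fin s) :
    a.dualValue m = idem _ (a.vertex m) * a.moment := by
  rw [moment, mul_sub]
  rfl

open Classical in
theorem moment_mul_substVertex (a : Q.Fan j s) : a.moment * a.substVertex j = a.moment := by
  rw [moment, sub_mul, Finset.sum_mul, Finset.sum_mul]
  congr 1 <;> refine Finset.sum_congr rfl fun b hb => ?_
  · rw [mul_assoc, a.split_mul_substVertex (by simpa using hb)]
  · rw [mul_assoc, a.splitDual_mul_substVertex (Finset.mem_filter.1 hb).2.1]

open Classical in
theorem moment_eq_sum (a : Q.Fan j s) :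
    a.moment = ∑ b with b ∉ Set.range a.arr,
      ((if Q.tail b = j then a.splitDual b * a.split b else 0) -
        if Q.head b = j then a.split b * a.splitDual b else 0) := by
  rw [moment, Finset.sum_sub_distrib, ← Finset.sum_filter, ← Finset.sum_filter,
    Finset.filter_filter, Finset.filter_filter]
  congr 2
  · ext b
    simp only [Finset.mem_filter, Finset.mem_univ, true_and]
    exact ⟨fun h => ⟨a.notMem_of_tail h, h⟩, And.right⟩
  · ext b
    simp [and_comm]

/-- For `a_m*` the condition on the right holds because every summand of `moment` starts at a vertex
over `j`. For the idempotent at `j` the `v_m` must be distinct. -/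
theorem isRealization_subst (a : Q.Fan j s) : IsRealization Q a.substArrow a.substVertex where
  idem_mul := a.substVertex_mul_self
  head_mul x := by
    rcases x with b | b <;> by_cases hb : b ∈ Set.range a.arr
    · obtain ⟨m, rfl⟩ := hb
      rw [substArrow_inl_arr]
      exact (congrArg (a.substVertex · * _) (a.head_arr m)).trans (a.substVertex_mul_idem_vertex m)
    · rw [a.substArrow_inl hb]
      exact a.substVertex_mul_split rfl
    · obtain ⟨m, rfl⟩ := hb
      rw [substArrow_inr_arr, dualValue_eq, ← mul_assoc]
      exact congrArg (· * _)
        ((congrArg (· * _) (a.substVertex_of_ne (a.tail_ne m))).trans (idem_mul_self _))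
    · rw [a.substArrow_inr hb]
      exact a.substVertex_mul_splitDual rfl
  mul_tail x := by
    rcases x with b | b <;> by_cases hb : b ∈ Set.range a.arr
    · obtain ⟨m, rfl⟩ := hb
      rw [substArrow_inl_arr]
      exact (congrArg (_ * ·) (a.substVertex_of_ne (a.tail_ne m))).trans (idem_mul_self _)
    · rw [a.substArrow_inl hb]
      exact a.split_mul_substVertex rfl
    · obtain ⟨m, rfl⟩ := hb
      rw [substArrow_inr_arr, dualValue_eq, mul_assoc]
      exact congrArg (_ * ·)
        ((congrArg (_ * a.substVertex ·) (a.head_arr m)).trans a.moment_mul_substVertex)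
    · rw [a.substArrow_inr hb]
      exact a.splitDual_mul_substVertex rfl

/-- The substitution on the path algebra. It is multiplicative only on composable paths. -/
noncomputable def evalSubst (a : Q.Fan j s) :
    Q.double.PathAlgebra →ₗ[ℂ] (Q.contract a).double.PathAlgebra :=
  evalPath Q a.substArrow a.substVertex

theorem evalSubst_ofPath (a : Q.Fan j s) (p : Q.double.Path) :
    a.evalSubst (ofPath p) = a.substPath p := by
  rw [substPath]
  split_ifs with h
  · have hp := p.isWalk
    rw [h] at hp
    rw [evalSubst, evalPath_ofPath, h, show p.tgt = p.src from hp]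
    simp
  · exact evalPath_ofPath_of_ne a.isRealization_subst h

theorem evalSubst_mem (a : Q.Fan j s) (p : Q.double.Path) :
    a.evalSubst (ofPath p) ∈ (Q.contract a).homogeneous (dualCount p.word) := by
  rw [evalSubst, evalPath_ofPath]
  simpa using mul_mem_homogeneous (a.substVertex_mem p.tgt) (a.prod_substArrow_mem p.word)

theorem subst_ofPath (a : Q.Fan j s) {p : Q.double.Path} (h : p.tgt = p.src) :
    a.subst (Q.toPolyvector (ofPath p)) = (Q.contract a).toPolyvector (a.evalSubst (ofPath p)) := by
  rw [evalSubst_ofPath, ← a.substClosed_closed h]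
  exact lift_ofPath _ p

theorem subst_ofPath_of_ne (a : Q.Fan j s) {p : Q.double.Path} (h : p.tgt ≠ p.src) :
    a.subst (Q.toPolyvector (ofPath p)) = 0 := by
  rw [← a.substClosed_of_ne h]
  exact lift_ofPath _ p

/-- The corners make all paths involved composable, the only situation in which the substitution
respects products. -/
theorem subst_toPolyvector_mul (a : Q.Fan j s) {i k : V} {x y : Q.double.PathAlgebra}
    (hx : x ∈ corner Q.double i k) (hy : y ∈ corner Q.double k i) :
    a.subst (Q.toPolyvector (x * y)) =
      (Q.contract a).toPolyvector (a.evalSubst x * a.evalSubst y) := by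
  induction hx using Submodule.span_induction with
  | zero => simp
  | add x x' _ _ hx hx' => simp only [add_mul, map_add, hx, hx']
  | smul c x _ hx => simp only [smul_mul_assoc, map_smul, hx]
  | mem x hx =>
    obtain ⟨p, rfl, rfl, rfl⟩ := hx
    induction hy using Submodule.span_induction with
    | zero => simp
    | add y y' _ _ hy hy' => simp only [mul_add, map_add, hy, hy']
    | smul c y _ hy => simp only [mul_smul_comm, map_smul, hy]
    | mem y hy =>
      obtain ⟨q, h1, h2, rfl⟩ := hy
      rw [ofPath_mul_ofPath, dif_pos h1.symm, subst_ofPath, evalSubst,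
        evalPath_comp a.isRealization_subst]
      exact h2.symm

theorem subst_mem_polyvectorDegree (a : Q.Fan j s) {P : Q.Polyvector} {r : ℕ}
    (hP : P ∈ Q.polyvectorDegree r) : a.subst P ∈ (Q.contract a).polyvectorDegree r := by
  obtain ⟨x, hx, rfl⟩ := hP
  induction hx using Submodule.span_induction with
  | zero => simp
  | add x x' _ _ hx hx' => rw [map_add, map_add]; exact add_mem hx hx'
  | smul c x _ hx => rw [map_smul, map_smul]; exact Submodule.smul_mem _ _ hx
  | mem x hx =>
    obtain ⟨p, rfl, rfl⟩ := hx
    by_cases h : p.tgt = p.src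
    · rw [a.subst_ofPath h]
      exact Submodule.mem_map_of_mem (a.evalSubst_mem p)
    · rw [a.subst_ofPath_of_ne h]
      exact zero_mem _

end Fan

/-! ### Closed paths of fixed degree -/

section

variable {V E : Type*} {Q : ArrowQuiver V E}

theorem dualCount_inl (b : E) : dualCount [(Sum.inl b : E ⊕ E)] = 0 := rfl

theorem dualCount_inr (b : E) : dualCount [(Sum.inr b : E ⊕ E)] = 1 := rfl

theorem double_head_inl (b : E) : Q.double.head (Sum.inl b) = Q.head b := rfl

theorem double_head_inr (b : E) : Q.double.head (Sum.inr b) = Q.tail b := rfl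

theorem double_tail_inl (b : E) : Q.double.tail (Sum.inl b) = Q.tail b := rfl

theorem double_tail_inr (b : E) : Q.double.tail (Sum.inr b) = Q.head b := rfl

variable [DecidableEq V] [Fintype V]

/-- Rotating the idempotent at the target to the other side of `p` gives zero. -/
theorem toPolyvector_of_ne {p : Q.double.Path} (h : p.tgt ≠ p.src) :
    Q.toPolyvector (ofPath p) = 0 := by
  have h1 : idem Q.double p.tgt * ofPath p = ofPath p := (trivial_mul _ _).trans (if_pos rfl)
  have h2 : ofPath p * idem Q.double p.tgt = 0 := (mul_trivial _ _).trans (if_neg h)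
  rw [← h1, toPolyvector_mul_comm (idem_mem_homogeneous _) (ofPath_mem_homogeneous p), h2, map_zero,
    smul_zero]

@[elab_as_elim]
theorem polyvectorDegree_induction {r : ℕ}
    {motive : (P : Q.Polyvector) → P ∈ Q.polyvectorDegree r → Prop}
    (zero : motive 0 (zero_mem _))
    (add : ∀ x y hx hy, motive x hx → motive y hy → motive (x + y) (add_mem hx hy))
    (smul : ∀ (c : ℂ) x hx, motive x hx → motive (c • x) (Submodule.smul_mem _ c hx))
    (path : ∀ (p : Q.double.Path) (_ : p.tgt = p.src) (hp : dualCount p.word = r),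
      motive (Q.toPolyvector (ofPath p))
        (Submodule.mem_map_of_mem (hp ▸ ofPath_mem_homogeneous p)))
    {P : Q.Polyvector} (hP : P ∈ Q.polyvectorDegree r) : motive P hP := by
  -- The motive depends on the proof of membership, so both are built together.
  suffices h : ∃ h, motive P h from h.2
  obtain ⟨x, hx, rfl⟩ := hP
  induction hx using Submodule.span_induction with
  | zero => rw [map_zero]; exact ⟨_, zero⟩
  | add x y _ _ hx hy => rw [map_add]; exact ⟨_, add _ _ hx.1 hy.1 hx.2 hy.2⟩
  | smul c x _ hx => rw [map_smul]; exact ⟨_, smul c _ hx.1 hx.2⟩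
  | mem x hx =>
    obtain ⟨p, hp, rfl⟩ := hx
    by_cases h : p.tgt = p.src
    · exact ⟨_, path p h hp⟩
    · rw [toPolyvector_of_ne h]
      exact ⟨_, zero⟩

theorem toPolyvector_mul_comm_zero {x y : Q.double.PathAlgebra} {t : ℕ}
    (hx : x ∈ Q.homogeneous 0) (hy : y ∈ Q.homogeneous t) :
    Q.toPolyvector (x * y) = Q.toPolyvector (y * x) := by
  rw [toPolyvector_mul_comm hx hy, zero_mul, pow_zero, one_smul]

theorem toPolyvector_mul_comm_one_two {x y : Q.double.PathAlgebra}
    (hx : x ∈ Q.homogeneous 1) (hy : y ∈ Q.homogeneous 2) :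
    Q.toPolyvector (x * y) = Q.toPolyvector (y * x) := by
  rw [toPolyvector_mul_comm hx hy]
  norm_num

end

/-! ### The chain rule and the derivatives of the contracted bivector -/

namespace Fan

variable {V E : Type*} {Q : ArrowQuiver V E} {j : V} {s : ℕ} [DecidableEq V] [Fintype V]
  [Fintype E]

/-- The superderivative of a polyvector field of `Q` after substitution. -/
noncomputable def substDeriv (a : Q.Fan j s) (w : E ⊕ E) :
    Q.Polyvector →ₗ[ℂ] (Q.contract a).double.PathAlgebra :=
  a.evalSubst ∘ₗ Q.superDeriv w

theorem substDeriv_ofPath (a : Q.Fan j s) (w : E ⊕ E) {p : Q.double.Path}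
    (h : p.tgt = p.src) (hp : dualCount p.word = 2) :
    a.substDeriv w (Q.toPolyvector (ofPath p)) =
      cyclicDeriv Q a.substArrow a.substVertex w p.word 1 := by
  rw [substDeriv, LinearMap.comp_apply, superDeriv_toPolyvector, evalSubst,
    evalPath_superDerivPath a.isRealization_subst w h (r := 1) hp]

theorem substDeriv_mem (a : Q.Fan j s) (w : E ⊕ E) {P : Q.Polyvector}
    (hP : P ∈ Q.polyvectorDegree 2) {d : ℕ} (hd : d + dualCount [w] = 2) :
    a.substDeriv w P ∈ (Q.contract a).homogeneous d := by
  induction hP using polyvectorDegree_induction with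
  | zero => simp
  | add x y _ _ hx hy => rw [map_add]; exact add_mem hx hy
  | smul c x _ hx => rw [map_smul]; exact Submodule.smul_mem _ _ hx
  | path p h hp =>
    rw [a.substDeriv_ofPath w h hp]
    exact cyclicDeriv_mem_homogeneous a.substArrow_mem a.substVertex_mem w _ one_mem_homogeneous
      (by omega)

theorem tail_mul_substDeriv (a : Q.Fan j s) (w : E ⊕ E) {P : Q.Polyvector}
    (hP : P ∈ Q.polyvectorDegree 2) :
    a.substVertex (Q.double.tail w) * a.substDeriv w P = a.substDeriv w P := by
  induction hP using polyvectorDegree_induction with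
  | zero => simp
  | add x y _ _ hx hy => rw [map_add, mul_add, hx, hy]
  | smul c x _ hx => rw [map_smul, mul_smul_comm, hx]
  | path p h hp => rw [a.substDeriv_ofPath w h hp, tail_mul_cyclicDeriv a.isRealization_subst]

theorem substDeriv_mul_head (a : Q.Fan j s) (w : E ⊕ E) {P : Q.Polyvector}
    (hP : P ∈ Q.polyvectorDegree 2) :
    a.substDeriv w P * a.substVertex (Q.double.head w) = a.substDeriv w P := by
  induction hP using polyvectorDegree_induction with
  | zero => simp
  | add x y _ _ hx hy => rw [map_add, add_mul, hx, hy]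
  | smul c x _ hx => rw [map_smul, smul_mul_assoc, hx]
  | path p h hp => rw [a.substDeriv_ofPath w h hp, cyclicDeriv_mul_head a.isRealization_subst]

/-- This is the vertex identity with `z = 1`: on a closed path of degree two the two boundary terms
cancel. -/
theorem sum_mul_substDeriv (a : Q.Fan j s) {P : Q.Polyvector} (hP : P ∈ Q.polyvectorDegree 2) :
    (∑ w, if Q.double.head w = j then
        (-1 : ℂ) ^ dualCount [w] • (a.substArrow w * a.substDeriv w P) else 0) =
      ∑ w, if Q.double.tail w = j then a.substDeriv w P * a.substArrow w else 0 := by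
  induction hP using polyvectorDegree_induction with
  | zero => simp
  | add x y _ _ hx hy =>
    simp only [map_add, mul_add, add_mul, smul_add, ite_add_zero, Finset.sum_add_distrib, hx, hy]
  | smul c x _ hx =>
    have := congrArg (c • ·) hx
    simp only [Finset.smul_sum, smul_ite, smul_zero] at this
    simp only [map_smul, mul_smul_comm, smul_mul_assoc]
    rw [← this]
    refine Finset.sum_congr rfl fun w _ => ?_
    rw [smul_comm]
  | path p h hp =>
    simp only [a.substDeriv_ofPath _ h hp]
    rw [← sub_eq_zero, sum_mul_cyclicDeriv a.isRealization_subst j p.isWalk, h, hp]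
    simp

/-- Derivatives kill the vertex values, so the Leibniz rule moves these from the differentiated
element onto `z`. -/
theorem insertDeriv_substArrow (a : Q.Fan j s) (c : a.Arrow ⊕ a.Arrow) (x : E ⊕ E)
    (z : (Q.contract a).double.PathAlgebra) :
    insertDeriv (Q.contract a) c (a.substArrow x)
      (a.substVertex (Q.double.tail x) * z * a.substVertex (Q.double.head x)) =
    insertDeriv (Q.contract a) c (a.substArrow x) z := by
  have h0 (i : V) (y) : insertDeriv (Q.contract a) c (a.substVertex i) y = 0 := by
    by_cases h : i = j
    · subst h
      rw [a.substVertex_self, map_sum, LinearMap.sum_apply]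
      exact Finset.sum_eq_zero fun m _ => insertDeriv_idem _ _ _
    · rw [a.substVertex_of_ne h, insertDeriv_idem]
  have hf := a.isRealization_subst
  nth_rw 2 [← hf.head_mul x]
  rw [insertDeriv_mul c (a.substVertex_mem _), h0, zero_add, pow_zero, one_smul]
  nth_rw 2 [← hf.mul_tail x]
  rw [insertDeriv_mul c (a.substArrow_mem x), h0, smul_zero, add_zero, mul_assoc]

/-- The chain rule, by induction with the Leibniz rule: the rest of the word, rotated around the
letter, is what gets inserted into the value of that letter. -/
theorem insertDeriv_prod_substArrow (a : Q.Fan j s) (c : a.Arrow ⊕ a.Arrow) (l : List (E ⊕ E))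
    (z : (Q.contract a).double.PathAlgebra) :
    insertDeriv (Q.contract a) c (l.map a.substArrow).prod z =
      ∑ w, (-1 : ℂ) ^ dualCount [w] • insertDeriv (Q.contract a) c (a.substArrow w)
        (cyclicDeriv Q a.substArrow a.substVertex w l z) := by
  classical
  induction l generalizing z with
  | nil =>
    have h1 : (1 : (Q.contract a).double.PathAlgebra) = ∑ i, idem _ i := rfl
    rw [List.map_nil, List.prod_nil, h1, map_sum, LinearMap.sum_apply]
    simp [insertDeriv_idem]
  | cons x l ih =>
    rw [List.map_cons, List.prod_cons, insertDeriv_mul c (a.substArrow_mem x), ih,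
      Finset.smul_sum]
    simp only [cyclicDeriv_cons, map_add, smul_add, Finset.sum_add_distrib]
    congr 1
    · rw [Finset.sum_eq_single x]
      · rw [if_pos rfl, map_smul, smul_smul, neg_one_pow_mul_self, one_smul, mul_assoc (_ * _) z,
          mul_assoc (a.substVertex _), ← mul_assoc _ z, ← mul_assoc (a.substVertex _),
          insertDeriv_substArrow]
      · intro w _ hw
        rw [if_neg (Ne.symm hw), map_zero, smul_zero]
      · exact fun h => absurd (Finset.mem_univ _) h
    · refine Finset.sum_congr rfl fun w _ => ?_
      rw [map_smul, smul_comm]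

theorem superDeriv_subst (a : Q.Fan j s) (c : a.Arrow ⊕ a.Arrow) {P : Q.Polyvector}
    (hP : P ∈ Q.polyvectorDegree 2) :
    (Q.contract a).superDeriv c (a.subst P) = ∑ w, (-1 : ℂ) ^ dualCount [w] •
      insertDeriv (Q.contract a) c (a.substArrow w) (a.substDeriv w P) := by
  induction hP using polyvectorDegree_induction with
  | zero => simp
  | add x y _ _ hx hy => simp only [map_add, smul_add, Finset.sum_add_distrib, hx, hy]
  | smul r x _ hx =>
    simp only [map_smul, hx, Finset.smul_sum]
    exact Finset.sum_congr rfl fun w _ => smul_comm _ _ _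
  | path p h hp =>
    -- Degree two excludes trivial paths, so the value of `p` is a plain product.
    have hw : p.word ≠ [] := by
      intro h0
      rw [h0] at hp
      simp [dualCount] at hp
    have hm := a.evalSubst_mem p
    rw [hp] at hm
    rw [a.subst_ofPath h, superDeriv_eq_insertDeriv c (r := 1) hm, evalSubst,
      evalPath_ofPath_of_ne a.isRealization_subst hw, insertDeriv_prod_substArrow]
    simp only [a.substDeriv_ofPath _ h hp]

open Classical in
theorem insertDeriv_inl_split (a : Q.Fan j s) (c : a.Arrow) (b : E)
    (z : (Q.contract a).double.PathAlgebra) :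
    insertDeriv (Q.contract a) (Sum.inl c) (a.split b) z = if c.base = b then
      idem _ ((Q.contract a).tail c) * z * idem _ ((Q.contract a).head c) else 0 := by
  rw [split, map_sum, LinearMap.sum_apply]
  simp only [insertDeriv_arrow, Sum.inl.injEq]
  rw [Finset.sum_ite_eq']
  simp [dualCount_inl, double_head_inl, double_tail_inl]

open Classical in
theorem insertDeriv_inr_splitDual (a : Q.Fan j s) (c : a.Arrow) (b : E)
    (z : (Q.contract a).double.PathAlgebra) :
    insertDeriv (Q.contract a) (Sum.inr c) (a.splitDual b) z = if c.base = b then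
      -(idem _ ((Q.contract a).head c) * z * idem _ ((Q.contract a).tail c)) else 0 := by
  rw [splitDual, map_sum, LinearMap.sum_apply]
  simp only [insertDeriv_arrow, Sum.inr.injEq]
  rw [Finset.sum_ite_eq']
  simp [dualCount_inr, double_head_inr, double_tail_inr]

theorem insertDeriv_inr_split (a : Q.Fan j s) (c : a.Arrow) (b : E)
    (z : (Q.contract a).double.PathAlgebra) :
    insertDeriv (Q.contract a) (Sum.inr c) (a.split b) z = 0 := by
  rw [split, map_sum, LinearMap.sum_apply]
  simp [insertDeriv_arrow]

theorem insertDeriv_inl_splitDual (a : Q.Fan j s) (c : a.Arrow) (b : E)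
    (z : (Q.contract a).double.PathAlgebra) :
    insertDeriv (Q.contract a) (Sum.inl c) (a.splitDual b) z = 0 := by
  rw [splitDual, map_sum, LinearMap.sum_apply]
  simp [insertDeriv_arrow]

theorem insertDeriv_inl_moment (a : Q.Fan j s) (c : a.Arrow)
    (z : (Q.contract a).double.PathAlgebra) :
    insertDeriv (Q.contract a) (Sum.inl c) a.moment z =
      -(idem _ ((Q.contract a).tail c) *
        ((if Q.tail c.base = j then z * a.splitDual c.base else 0) +
          if Q.head c.base = j then a.splitDual c.base * z else 0) *
        idem _ ((Q.contract a).head c)) := by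
  classical
  rw [moment_eq_sum, map_sum, LinearMap.sum_apply, Finset.sum_eq_single c.base]
  · split_ifs <;>
    simp [insertDeriv_mul _ (a.splitDual_mem _), insertDeriv_mul _ (a.split_mem _),
      insertDeriv_inl_split, insertDeriv_inl_splitDual, mul_add, add_mul]
    abel
  · intro b _ hb
    split_ifs <;>
    simp [insertDeriv_mul _ (a.splitDual_mem _), insertDeriv_mul _ (a.split_mem _),
      insertDeriv_inl_split, insertDeriv_inl_splitDual, Ne.symm hb]
  · intro h
    exact absurd (by simpa using c.base_notMem) h

theorem insertDeriv_inr_moment (a : Q.Fan j s) (c : a.Arrow)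
    (z : (Q.contract a).double.PathAlgebra) :
    insertDeriv (Q.contract a) (Sum.inr c) a.moment z =
      -(idem _ ((Q.contract a).head c) *
        ((if Q.tail c.base = j then a.split c.base * z else 0) -
          if Q.head c.base = j then z * a.split c.base else 0) *
        idem _ ((Q.contract a).tail c)) := by
  classical
  rw [moment_eq_sum, map_sum, LinearMap.sum_apply, Finset.sum_eq_single c.base]
  · split_ifs <;>
    simp [insertDeriv_mul _ (a.splitDual_mem _), insertDeriv_mul _ (a.split_mem _),
      insertDeriv_inr_split, insertDeriv_inr_splitDual, mul_sub, sub_mul]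
    abel
  · intro b _ hb
    split_ifs <;>
    simp [insertDeriv_mul _ (a.splitDual_mem _), insertDeriv_mul _ (a.split_mem _),
      insertDeriv_inr_split, insertDeriv_inr_splitDual, Ne.symm hb]
  · intro h
    exact absurd (by simpa using c.base_notMem) h

/-- The sum over `m` of the superderivatives with respect to `a_m*`, after substitution. -/
noncomputable def fanDeriv (a : Q.Fan j s) (P : Q.Polyvector) :
    (Q.contract a).double.PathAlgebra :=
  ∑ m, a.substDeriv (Sum.inr (a.arr m)) P * idem _ (a.vertex m)

/-- Since `a_m*` goes to `e_{v_m} M`, the Leibniz rule moves `e_{v_m}` to the right of the inserted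
derivative; this is where `fanDeriv` comes from. -/
theorem sum_insertDeriv_dualValue (a : Q.Fan j s) (c : a.Arrow ⊕ a.Arrow) (P : Q.Polyvector) :
    ∑ m, insertDeriv (Q.contract a) c (a.dualValue m) (a.substDeriv (Sum.inr (a.arr m)) P) =
      insertDeriv (Q.contract a) c a.moment (a.fanDeriv P) := by
  rw [fanDeriv, map_sum]
  refine Finset.sum_congr rfl fun m _ => ?_
  rw [dualValue_eq, insertDeriv_mul c (idem_mem_homogeneous _), insertDeriv_idem, zero_add,
    pow_zero, one_smul]

/-- The superderivatives of the contracted polyvector field with respect to the arrows over `b`, up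
to idempotents. -/
noncomputable def arrowDeriv (a : Q.Fan j s) (P : Q.Polyvector) (b : E) :
    (Q.contract a).double.PathAlgebra :=
  a.substDeriv (Sum.inl b) P + ((if Q.tail b = j then a.fanDeriv P * a.splitDual b else 0) +
    if Q.head b = j then a.splitDual b * a.fanDeriv P else 0)

/-- The superderivatives of the contracted polyvector field with respect to the dual arrows over
`b`, up to idempotents. -/
noncomputable def dualDeriv (a : Q.Fan j s) (P : Q.Polyvector) (b : E) :
    (Q.contract a).double.PathAlgebra :=
  a.substDeriv (Sum.inr b) P + ((if Q.tail b = j then a.split b * a.fanDeriv P else 0) -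
    if Q.head b = j then a.fanDeriv P * a.split b else 0)

/-- In the chain rule the `a_m` drop out, as their values are idempotents, and the `a_m*` contribute
only through `moment`. Of the other arrows only the one under `c` and its dual can contribute. -/
theorem superDeriv_subst_eq (a : Q.Fan j s) (c : a.Arrow ⊕ a.Arrow) {P : Q.Polyvector}
    (hP : P ∈ Q.polyvectorDegree 2) :
    (Q.contract a).superDeriv c (a.subst P) =
      insertDeriv (Q.contract a) c (a.split (c.elim Arrow.base Arrow.base))
          (a.substDeriv (Sum.inl (c.elim Arrow.base Arrow.base)) P) -
        insertDeriv (Q.contract a) c (a.splitDual (c.elim Arrow.base Arrow.base))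
          (a.substDeriv (Sum.inr (c.elim Arrow.base Arrow.base)) P) -
        insertDeriv (Q.contract a) c a.moment (a.fanDeriv P) := by
  classical
  set b := c.elim Arrow.base Arrow.base with hb
  have hm : b ∈ Finset.univ.filter (fun b => b ∉ Set.range a.arr) := by
    rw [Finset.mem_filter]
    cases c with
    | inl c => exact ⟨Finset.mem_univ _, c.base_notMem⟩
    | inr c => exact ⟨Finset.mem_univ _, c.base_notMem⟩
  have h1 : ∑ x with x ∉ Set.range a.arr, insertDeriv (Q.contract a) c
      (a.substArrow (Sum.inl x)) (a.substDeriv (Sum.inl x) P) =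
      insertDeriv (Q.contract a) c (a.split b) (a.substDeriv (Sum.inl b) P) := by
    rw [Finset.sum_eq_single_of_mem b hm, a.substArrow_inl (Finset.mem_filter.1 hm).2]
    intro x hx hxb
    rw [a.substArrow_inl (Finset.mem_filter.1 hx).2]
    cases c with
    | inl c => exact (a.insertDeriv_inl_split _ _ _).trans (if_neg (Ne.symm hxb))
    | inr c => rw [insertDeriv_inr_split]
  have h2 : ∑ x with x ∉ Set.range a.arr, insertDeriv (Q.contract a) c
      (a.substArrow (Sum.inr x)) (a.substDeriv (Sum.inr x) P) =
      insertDeriv (Q.contract a) c (a.splitDual b) (a.substDeriv (Sum.inr b) P) := by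
    rw [Finset.sum_eq_single_of_mem b hm, a.substArrow_inr (Finset.mem_filter.1 hm).2]
    intro x hx hxb
    rw [a.substArrow_inr (Finset.mem_filter.1 hx).2]
    cases c with
    | inl c => rw [insertDeriv_inl_splitDual]
    | inr c => exact (a.insertDeriv_inr_splitDual _ _ _).trans (if_neg (Ne.symm hxb))
  rw [a.superDeriv_subst _ hP, Fintype.sum_sum_type, a.sum_eq_sum_arr_add, a.sum_eq_sum_arr_add]
  simp only [substArrow_inl_arr, substArrow_inr_arr, insertDeriv_idem, smul_zero,
    Finset.sum_const_zero, zero_add, dualCount_inl, dualCount_inr, pow_zero, pow_one, one_smul,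
    ← Finset.smul_sum]
  rw [sum_insertDeriv_dualValue, h1, h2, neg_one_smul, neg_one_smul]
  abel

theorem superDeriv_inl_subst (a : Q.Fan j s) (c : a.Arrow) {P : Q.Polyvector}
    (hP : P ∈ Q.polyvectorDegree 2) :
    (Q.contract a).superDeriv (Sum.inl c) (a.subst P) =
      idem _ ((Q.contract a).tail c) * a.arrowDeriv P c.base * idem _ ((Q.contract a).head c) := by
  rw [a.superDeriv_subst_eq _ hP, Sum.elim_inl, insertDeriv_inl_split, if_pos rfl,
    insertDeriv_inl_splitDual, insertDeriv_inl_moment, sub_zero, sub_neg_eq_add, arrowDeriv,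
    mul_add _ (a.substDeriv _ P), add_mul _ _ (idem _ _)]

theorem superDeriv_inr_subst (a : Q.Fan j s) (c : a.Arrow) {P : Q.Polyvector}
    (hP : P ∈ Q.polyvectorDegree 2) :
    (Q.contract a).superDeriv (Sum.inr c) (a.subst P) =
      idem _ ((Q.contract a).head c) * a.dualDeriv P c.base * idem _ ((Q.contract a).tail c) := by
  rw [a.superDeriv_subst_eq _ hP, Sum.elim_inr, insertDeriv_inr_splitDual, if_pos rfl,
    insertDeriv_inr_split, insertDeriv_inr_moment, zero_sub, neg_neg, sub_neg_eq_add, dualDeriv,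
    mul_add _ (a.substDeriv _ P), add_mul _ _ (idem _ _)]

end Fan

/-- All products have total degree three, and rotating a factor of degree zero, or one of degree one
past one of degree two, costs no sign. If both `t` and `h` hold (a loop at `j`), the mixed terms `B
Y B' Y` and `Y B Y B'` cancel. -/
theorem toPolyvector_cyclic_identity {V E : Type*} [DecidableEq V] [Fintype V]
    {R : ArrowQuiver V E} {X X' Y B B' : R.double.PathAlgebra} {t h : Prop} [Decidable t]
    [Decidable h] (hX : X ∈ R.homogeneous 2) (hX' : X' ∈ R.homogeneous 1)
    (hY : Y ∈ R.homogeneous 1) (hB : B ∈ R.homogeneous 0) (hB' : B' ∈ R.homogeneous 1) :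
    R.toPolyvector
        ((X' + ((if t then B * Y else 0) - if h then Y * B else 0)) *
          (X + ((if t then Y * B' else 0) + if h then B' * Y else 0))) =
      R.toPolyvector (X' * X) + R.toPolyvector (Y *
        ((if t then X * B + B' * X' + Y * (B' * B) else 0) +
          if h then X' * B' - B * X - Y * (B * B') else 0)) := by
  have e1 := toPolyvector_mul_comm_zero hB (mul_mem_homogeneous hY hX)
  have e2 := toPolyvector_mul_comm_one_two hX' (mul_mem_homogeneous (r := 1) (t := 1) hY hB')
  have e3 := toPolyvector_mul_comm_one_two hY (mul_mem_homogeneous (r := 1) (t := 1) hX' hB')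
  have e4 := toPolyvector_mul_comm_zero hB (mul_mem_homogeneous hY (mul_mem_homogeneous hY hB'))
  have hYB : Y * B ∈ R.homogeneous 1 := mul_mem_homogeneous (r := 1) (t := 0) hY hB
  have hBY : B * Y ∈ R.homogeneous 1 := mul_mem_homogeneous (r := 0) (t := 1) hB hY
  have e5 := toPolyvector_mul_comm_one_two hY (mul_mem_homogeneous (r := 1) (t := 1) hYB hB')
  have e6 := toPolyvector_mul_comm_one_two hY (mul_mem_homogeneous (r := 1) (t := 1) hBY hB')
  simp only [mul_assoc] at e1 e2 e3 e4 e5 e6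
  by_cases ht : t <;> by_cases hh : h <;>
  simp only [ht, hh, if_true, if_false, mul_add, add_mul, mul_sub, sub_mul, mul_assoc, map_add,
    map_sub, map_zero, mul_zero, add_zero, zero_add, sub_zero, zero_sub, map_neg,
    neg_mul, e1, e2, ← e3, e4, ← e5, ← e6] <;>
  abel

/-! ### Comparison of the two brackets -/

namespace Fan

variable {V E : Type*} {Q : ArrowQuiver V E} {j : V} {s : ℕ} [DecidableEq V] [Fintype V]
  [Fintype E]

theorem fanDeriv_mem (a : Q.Fan j s) {P : Q.Polyvector} (hP : P ∈ Q.polyvectorDegree 2) :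
    a.fanDeriv P ∈ (Q.contract a).homogeneous 1 :=
  sum_mem fun _ _ => mul_mem_homogeneous (r := 1) (t := 0) (a.substDeriv_mem _ hP rfl)
    (idem_mem_homogeneous _)

theorem substVertex_mul_fanDeriv (a : Q.Fan j s) {P : Q.Polyvector}
    (hP : P ∈ Q.polyvectorDegree 2) : a.substVertex j * a.fanDeriv P = a.fanDeriv P := by
  rw [fanDeriv, Finset.mul_sum]
  refine Finset.sum_congr rfl fun m _ => ?_
  have h := a.tail_mul_substDeriv (Sum.inr (a.arr m)) hP
  rw [double_tail_inr] at h
  rw [← mul_assoc]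
  exact congrArg (· * _) ((congrArg (a.substVertex · * _) (a.head_arr m)).symm.trans h)

theorem fanDeriv_mul_substVertex (a : Q.Fan j s) (P : Q.Polyvector) :
    a.fanDeriv P * a.substVertex j = a.fanDeriv P := by
  rw [fanDeriv, Finset.sum_mul]
  exact Finset.sum_congr rfl fun m _ => by rw [mul_assoc, idem_vertex_mul_substVertex]

/-- Orthogonality of the `e_{v_m}` leaves only the diagonal terms of the double sum. -/
theorem fanDeriv_mul_sum (a : Q.Fan j s) {P : Q.Polyvector} (hP : P ∈ Q.polyvectorDegree 2) :
    a.fanDeriv P * ∑ m, idem _ (a.vertex m) * a.substDeriv (Sum.inl (a.arr m)) P =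
      ∑ m, a.substDeriv (Sum.inr (a.arr m)) P * a.substDeriv (Sum.inl (a.arr m)) P := by
  have h (m : Fin s) : a.substDeriv (Sum.inr (a.arr m)) P * idem _ (a.vertex m) =
      a.substDeriv (Sum.inr (a.arr m)) P := by
    have h := a.substDeriv_mul_head (Sum.inr (a.arr m)) hP
    rwa [double_head_inr, a.substVertex_of_ne (a.tail_ne m)] at h
  rw [fanDeriv, Finset.sum_mul_sum]
  refine Finset.sum_congr rfl fun m _ => ?_
  rw [Finset.sum_eq_single_of_mem m (Finset.mem_univ _)]
  · rw [mul_assoc (a.substDeriv _ P), ← mul_assoc (idem _ _) (idem _ _), idem_mul_self,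
      ← mul_assoc, h]
  · intro n _ hn
    rw [mul_assoc (a.substDeriv _ P), ← mul_assoc (idem _ _) (idem _ _), idem_mul_idem,
      if_neg (a.vertex_injective.ne (Ne.symm hn)), zero_mul, mul_zero]

theorem sandwich_dualDeriv (a : Q.Fan j s) {P : Q.Polyvector} (hP : P ∈ Q.polyvectorDegree 2)
    (b : E) :
    a.substVertex (Q.head b) * a.dualDeriv P b * a.substVertex (Q.tail b) = a.dualDeriv P b := by
  have h1 := a.tail_mul_substDeriv (Sum.inr b) hP
  have h2 := a.substDeriv_mul_head (Sum.inr b) hP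
  rw [double_tail_inr] at h1
  rw [double_head_inr] at h2
  have h3 (h : Q.tail b = j) : a.substVertex (Q.head b) * (a.split b * a.fanDeriv P) *
      a.substVertex (Q.tail b) = a.split b * a.fanDeriv P := by
    rw [← mul_assoc, a.substVertex_mul_split rfl, mul_assoc]
    exact congrArg (_ * ·)
      ((congrArg (_ * a.substVertex ·) h).trans (a.fanDeriv_mul_substVertex P))
  have h4 (h : Q.head b = j) : a.substVertex (Q.head b) * (a.fanDeriv P * a.split b) *
      a.substVertex (Q.tail b) = a.fanDeriv P * a.split b := by
    rw [mul_assoc, mul_assoc, a.split_mul_substVertex rfl, ← mul_assoc]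
    exact congrArg (· * _)
      ((congrArg (a.substVertex · * _) h).trans (a.substVertex_mul_fanDeriv hP))
  rw [dualDeriv, mul_add, mul_sub, add_mul, sub_mul, h1, h2]
  congr 2 <;> split_ifs with h
  · exact h3 h
  · simp
  · exact h4 h
  · simp

theorem arrowDeriv_mem (a : Q.Fan j s) {P : Q.Polyvector} (hP : P ∈ Q.polyvectorDegree 2)
    (b : E) : a.arrowDeriv P b ∈ (Q.contract a).homogeneous 2 := by
  have hY := a.fanDeriv_mem hP
  have hB := a.splitDual_mem b
  rw [arrowDeriv]
  refine add_mem (a.substDeriv_mem _ hP rfl) (add_mem ?_ ?_) <;> split_ifs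
  · exact mul_mem_homogeneous (r := 1) (t := 1) hY hB
  · exact zero_mem _
  · exact mul_mem_homogeneous (r := 1) (t := 1) hB hY
  · exact zero_mem _

theorem dualDeriv_mem (a : Q.Fan j s) {P : Q.Polyvector} (hP : P ∈ Q.polyvectorDegree 2)
    (b : E) : a.dualDeriv P b ∈ (Q.contract a).homogeneous 1 := by
  have hY := a.fanDeriv_mem hP
  have hB := a.split_mem b
  rw [dualDeriv]
  refine add_mem (a.substDeriv_mem _ hP rfl) (sub_mem ?_ ?_) <;> split_ifs
  · exact mul_mem_homogeneous (r := 0) (t := 1) hB hY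
  · exact zero_mem _
  · exact mul_mem_homogeneous (r := 1) (t := 0) hY hB
  · exact zero_mem _

/-- The terms of the vertex identity at `j` which come from the arrow `b`. -/
noncomputable def vertexTerm (a : Q.Fan j s) (P : Q.Polyvector) (b : E) :
    (Q.contract a).double.PathAlgebra :=
  (if Q.tail b = j then a.substDeriv (Sum.inl b) P * a.split b +
    a.splitDual b * a.substDeriv (Sum.inr b) P +
    a.fanDeriv P * (a.splitDual b * a.split b) else 0) +
  if Q.head b = j then a.substDeriv (Sum.inr b) P * a.splitDual b -
    a.split b * a.substDeriv (Sum.inl b) P -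
    a.fanDeriv P * (a.split b * a.splitDual b) else 0

-- This is the vertex identity at `j`, solved for the terms of the `a_m`. The terms of the `a_m*`
-- add up to `fanDeriv * moment`, which is then distributed over the arrows `b`.
open Classical in
theorem sum_vertexTerm (a : Q.Fan j s) {P : Q.Polyvector} (hP : P ∈ Q.polyvectorDegree 2) :
    ∑ b with b ∉ Set.range a.arr, a.vertexTerm P b =
      ∑ m, idem _ (a.vertex m) * a.substDeriv (Sum.inl (a.arr m)) P := by
  have h := a.sum_mul_substDeriv hP
  have hY : ∑ m, a.substDeriv (Sum.inr (a.arr m)) P * a.dualValue m =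
      a.fanDeriv P * a.moment := by
    rw [fanDeriv, Finset.sum_mul]
    exact Finset.sum_congr rfl fun m _ => by rw [dualValue_eq, mul_assoc]
  rw [Fintype.sum_sum_type, Fintype.sum_sum_type] at h
  simp only [dualCount_inl, dualCount_inr, pow_zero, one_smul, pow_one, neg_one_smul] at h
  change (∑ b, if Q.head b = j then _ else 0) + (∑ b, if Q.tail b = j then _ else 0) =
    (∑ b, if Q.tail b = j then _ else 0) + (∑ b, if Q.head b = j then _ else 0) at h
  simp only [a.sum_eq_sum_arr_add, a.head_arr, a.tail_ne, if_true, if_false,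
    Finset.sum_const_zero, zero_add, substArrow_inl_arr, substArrow_inr_arr, hY] at h
  have hM := congrArg (a.fanDeriv P * ·) a.moment_eq_sum
  simp only [Finset.mul_sum] at hM
  rw [hM] at h
  rw [← sub_eq_zero] at h ⊢
  rw [← neg_eq_zero, ← h]
  have key : ∀ b ∈ Finset.univ.filter (fun b => b ∉ Set.range a.arr), a.vertexTerm P b =
      (if Q.tail b = j then a.substDeriv (Sum.inl b) P * a.substArrow (Sum.inl b) else 0) +
      (if Q.head b = j then a.substDeriv (Sum.inr b) P * a.substArrow (Sum.inr b) else 0) +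
      a.fanDeriv P * ((if Q.tail b = j then a.splitDual b * a.split b else 0) -
        if Q.head b = j then a.split b * a.splitDual b else 0) -
      (if Q.head b = j then a.substArrow (Sum.inl b) * a.substDeriv (Sum.inl b) P else 0) -
      (if Q.tail b = j then -(a.substArrow (Sum.inr b) * a.substDeriv (Sum.inr b) P) else 0) := by
    intro b hb
    rw [a.substArrow_inl (Finset.mem_filter.1 hb).2, a.substArrow_inr (Finset.mem_filter.1 hb).2,
      vertexTerm]
    split_ifs <;> simp only [mul_sub, mul_zero] <;> abel
  rw [Finset.sum_congr rfl key]
  simp only [Finset.sum_add_distrib, Finset.sum_sub_distrib]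
  abel

theorem toPolyvector_dualDeriv_mul_arrowDeriv (a : Q.Fan j s) {P : Q.Polyvector}
    (hP : P ∈ Q.polyvectorDegree 2) (b : E) :
    (Q.contract a).toPolyvector (a.dualDeriv P b * a.arrowDeriv P b) =
      (Q.contract a).toPolyvector (a.substDeriv (Sum.inr b) P * a.substDeriv (Sum.inl b) P) +
        (Q.contract a).toPolyvector (a.fanDeriv P * a.vertexTerm P b) :=
  toPolyvector_cyclic_identity (a.substDeriv_mem (Sum.inl b) hP rfl)
    (a.substDeriv_mem (Sum.inr b) hP rfl) (a.fanDeriv_mem hP) (a.split_mem b) (a.splitDual_mem b)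

theorem toPolyvector_sum_superDeriv_subst (a : Q.Fan j s) {P : Q.Polyvector}
    (hP : P ∈ Q.polyvectorDegree 2) :
    (Q.contract a).toPolyvector (∑ c, (Q.contract a).superDeriv (Sum.inr c) (a.subst P) *
        (Q.contract a).superDeriv (Sum.inl c) (a.subst P)) =
      a.subst (Q.toPolyvector
        (∑ b, Q.superDeriv (Sum.inr b) P * Q.superDeriv (Sum.inl b) P)) := by
  classical
  -- The two inner idempotents merge, and the last one is rotated to the front, where it merges with
  -- the first.
  have h1 (c : a.Arrow) : (Q.contract a).toPolyvector
      ((Q.contract a).superDeriv (Sum.inr c) (a.subst P) *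
        (Q.contract a).superDeriv (Sum.inl c) (a.subst P)) =
      (Q.contract a).toPolyvector (idem _ ((Q.contract a).head c) * a.dualDeriv P c.base *
        idem _ ((Q.contract a).tail c) * a.arrowDeriv P c.base) := by
    have hm := mul_mem_homogeneous (mul_mem_homogeneous (mul_mem_homogeneous
      (idem_mem_homogeneous ((Q.contract a).head c)) (a.dualDeriv_mem hP c.base))
      (idem_mem_homogeneous ((Q.contract a).tail c))) (a.arrowDeriv_mem hP c.base)
    rw [a.superDeriv_inl_subst c hP, a.superDeriv_inr_subst c hP, mul_assoc (idem _ _ * _),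
      ← mul_assoc (idem _ _) (idem _ _ * _), ← mul_assoc (idem _ _) (idem _ _), idem_mul_self,
      ← mul_assoc, ← mul_assoc, ← toPolyvector_mul_comm_zero (idem_mem_homogeneous _) hm,
      ← mul_assoc, ← mul_assoc, ← mul_assoc, idem_mul_self]
  -- Summing the idempotents over all `c` above `b` gives the vertex values at the ends of `b`,
  -- which `dualDeriv` absorbs.
  have h2 (b : E) (hb : b ∉ Set.range a.arr) : ∑ c : a.Arrow with c.base = b,
      (Q.contract a).toPolyvector (idem _ ((Q.contract a).head c) * a.dualDeriv P c.base *
        idem _ ((Q.contract a).tail c) * a.arrowDeriv P c.base) =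
      (Q.contract a).toPolyvector (a.dualDeriv P b * a.arrowDeriv P b) := by
    conv_rhs => rw [← a.sandwich_dualDeriv hP b]
    rw [← a.sum_idem_mul_mul_idem hb, Finset.sum_mul, map_sum]
    refine Finset.sum_congr rfl fun c hc => ?_
    rw [(Finset.mem_filter.1 hc).2]
  have h3 (b : E) : a.subst (Q.toPolyvector (Q.superDeriv (Sum.inr b) P *
      Q.superDeriv (Sum.inl b) P)) = (Q.contract a).toPolyvector
        (a.substDeriv (Sum.inr b) P * a.substDeriv (Sum.inl b) P) :=
    a.subst_toPolyvector_mul (superDeriv_mem_corner (Sum.inr b) P)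
      (superDeriv_mem_corner (Sum.inl b) P)
  have h4 := congrArg (fun x => (Q.contract a).toPolyvector (a.fanDeriv P * x))
    (a.sum_vertexTerm hP)
  simp only [a.fanDeriv_mul_sum hP] at h4
  simp only [map_sum, h1, h3]
  -- The arrows of the contracted quiver are grouped by their base, and the terms of the `a_m` on
  -- the other side are traded for `fanDeriv` times the sum of the `vertexTerm`s.
  rw [← Finset.sum_fiberwise_of_maps_to
    (t := Finset.univ.filter (fun b => b ∉ Set.range a.arr)) (g := Arrow.base)
    (fun c _ => Finset.mem_filter.2 ⟨Finset.mem_univ _, c.base_notMem⟩),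
    Finset.sum_congr rfl fun b hb => h2 b (Finset.mem_filter.1 hb).2,
    a.sum_eq_sum_arr_add, ← map_sum _ (fun m => a.substDeriv (Sum.inr (a.arr m)) P * _), ← h4,
    Finset.mul_sum, map_sum, ← Finset.sum_add_distrib]
  refine Finset.sum_congr rfl fun b _ => ?_
  rw [a.toPolyvector_dualDeriv_mul_arrowDeriv hP, add_comm]

end Fan

end ArrowQuiver

theorem mainTheorem5 {V E : Type*} [DecidableEq V] [Fintype V] [Fintype E]
    (Q : ArrowQuiver V E) (j : V) (s : ℕ) (a : Q.Fan j s) (P : Q.Polyvector)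
    (hP : Q.IsPoisson P) : (Q.contract a).IsPoisson (a.subst P) := by
  refine ⟨a.subst_mem_polyvectorDegree hP.1, ?_⟩
  rw [ArrowQuiver.schouten_two_two, a.toPolyvector_sum_superDeriv_subst hP.1, ← map_smul,
    ← ArrowQuiver.schouten_two_two,
    hP.2, map_zero]
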